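/- A \emph{polyhedral map} $K$ on a closed surface (a connected compact $2$-manifold without boundary) is an embedding of a finite simple graph, the \emph{edge graph} $EG(K)$, in the surface such that the closures of the components of its complement (the \emph{facets}) are closed $2$-discs bounded by cycles of $EG(K)$ (of length at least $3$), and such that any two different facets are disjoint or meet in exactly one vertex or in exactly one edge. The \emph{dual map} $M$ of $K$ has the facets of $K$ as its vertices; two of them are adjacent in $EG(M)$ if the facets have an edge in common. The faces of $M$ correspond to the vertices of $K$: the boundary $\partial F$ of the face $F$ of $M$ that corresponds to a vertex $v$ of $K$ is the cycle in $EG(M)$ formed by the facets of $K$ that contain $v$ and by the edges dual to the edges of $K$ at $v$. A cycle $C$ in $EG(K)$ is \emph{contractible} if it bounds a $2$-disc made of facets, that is, if there is a set of facets of $K$ whose union is homeomorphic to the closed unit disc by a homeomorphism that carries $C$ onto the unit circle. Let $n$ be the number of vertices of $K$. A \emph{proper tree} is a subgraph $T$ of $EG(M)$ that is a (non-empty, connected) tree, with vertices $v_1,\dots,v_k$, such that \begin{enumerate} \item $\sum_{i=1}^{k}\deg(v_i)=n+2(k-1)$, where $\deg$ is the degree in $EG(M)$; \item whenever two vertices $u_1,u_2$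 of $T$ lie on a face $F$ of $M$, some path in $\partial F$ from $u_1$ to $u_2$ is contained in $T$; \item for every face $F$ of $M$, every path of $T$ that lies in $\partial F$ has length at most $q-2$, where $q$ is the length of $\partial F$. \end{enumerate} \textbf{Theorem.} Let $K$ be a polyhedral map on a closed surface. Then $EG(K)$ has a contractible Hamiltonian cycle if and only if the edge graph $EG(M)$ of the dual map $M$ of $K$ has a proper tree. -/

import Mathlib

open SimpleGraph

/-- A subgraph of a simple graph is a cycle if it is traced by a closed walk that is a cycle
(so it has length at least three). -/
def SimpleGraph.Subgraph.IsCycleGraph {V : Type*} {G : SimpleGraph V} (C : G.Subgraph) : Prop :=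
  ∃ (a : V) (w : G.Walk a a), w.IsCycle ∧ w.toSubgraph = C

/-- A complex of polygons on the vertex set `V`: a simple graph (the edge graph) and a set of
facets, each given by its boundary cycle, a cycle of the edge graph. -/
structure PolygonalComplex (V : Type*) where
  /-- The edge graph. -/
  graph : SimpleGraph V
  /-- The boundary cycles of the polygonal facets. -/
  facets : Set graph.Subgraph
  facets_isCycle : ∀ f ∈ facets, f.IsCycleGraph

namespace PolygonalComplex

variable {V : Type*} (K : PolygonalComplex V)

/-- The edge graph of the dual: its vertices are the facets, and two different facets are joined
if they have an edge in common. -/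
def dualGraph : SimpleGraph K.facets where
  Adj f g := f ≠ g ∧ ∃ u v, f.1.Adj u v ∧ g.1.Adj u v
  symm := ⟨fun _ _ ⟨hne, u, v, hf, hg⟩ => ⟨hne.symm, u, v, hg, hf⟩⟩
  loopless := ⟨fun _ h => h.1 rfl⟩

/-- The boundary of the face of the dual that corresponds to the vertex `v`: its vertices are the
facets through `v`, and its edges are dual to the edges at `v`. -/
def dualFace (v : V) : K.dualGraph.Subgraph where
  verts := {f | v ∈ f.1.verts}
  Adj f g := f ≠ g ∧ ∃ u, f.1.Adj v u ∧ g.1.Adj v u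
  adj_sub := fun ⟨hne, u, hf, hg⟩ => ⟨hne, v, u, hf, hg⟩
  edge_vert := fun ⟨_, _, hf, _⟩ => hf.fst_mem
  symm := ⟨fun _ _ ⟨hne, u, hf, hg⟩ => ⟨hne.symm, u, hg, hf⟩⟩

/-- A polygonal complex is a polyhedral map on a closed (connected) surface. -/
structure IsPolyhedralMap : Prop where
  connected : K.graph.Connected
  /-- Every edge lies in exactly two facets. -/
  edge_two_facets : ∀ u v, K.graph.Adj u v → {f ∈ K.facets | f.Adj u v}.ncard = 2
  /-- The facets around a vertex form a single cycle, so that the complex is a surface there. -/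
  vertex_cycle : ∀ v, (K.dualFace v).IsCycleGraph
  /-- Two different facets are disjoint or meet in exactly one vertex or in exactly one edge. -/
  facet_inter : ∀ f ∈ K.facets, ∀ g ∈ K.facets, f ≠ g →
    f ⊓ g = ⊥ ∨ (∃ v, f ⊓ g = K.graph.singletonSubgraph v) ∨
      ∃ (u v : V) (h : K.graph.Adj u v), f ⊓ g = K.graph.subgraphOfAdj h

/-! ### Geometric realization

The complex is realized in the real vector space on the vertices and the facets: a vertex is the
corresponding unit vector, an edge is a segment, and a facet is the cone over its boundary cycle,
with the unit vector of the facet as its apex (a polygon cut into triangles at its centre). The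
union of all facets is the surface that carries the map. -/

open Classical in
/-- The unit vector at a vertex (`Sum.inl`) or at the centre of a facet (`Sum.inr`). -/
noncomputable def point (i : V ⊕ K.facets) : V ⊕ K.facets → ℝ := Pi.single i 1

/-- The union of the edges of a subgraph of the edge graph. -/
def edgeRegion (C : K.graph.Subgraph) : Set (V ⊕ K.facets → ℝ) :=
  {x | ∃ u v, C.Adj u v ∧ x ∈ segment ℝ (K.point (Sum.inl u)) (K.point (Sum.inl v))}

/-- The closed polygon of a facet. -/
def facetRegion (f : K.facets) : Set (V ⊕ K.facets → ℝ) :=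
  {x | ∃ u v, f.1.Adj u v ∧
    x ∈ convexHull ℝ {K.point (Sum.inl u), K.point (Sum.inl v), K.point (Sum.inr f)}}

/-- The union of the closed polygons of a set of facets; for the set of all facets this is the
whole surface. -/
def region (D : Set K.facets) : Set (V ⊕ K.facets → ℝ) :=
  ⋃ f ∈ D, K.facetRegion f

/-- A cycle `C` bounds the union of the facets in `D` as a 2-disc: the union is homeomorphic to the
closed unit disc in such a way that `C` corresponds to the unit circle. -/
def BoundsDisc (C : K.graph.Subgraph) (D : Set K.facets) : Prop :=
  ∃ h : K.region D ≃ₜ Metric.closedBall (0 : ℂ) 1,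
    ∀ x : K.region D, (h x : ℂ) ∈ Metric.sphere (0 : ℂ) 1 ↔ (x : V ⊕ K.facets → ℝ) ∈ K.edgeRegion C

/-- The edge graph has a Hamiltonian cycle that bounds a 2-disc made of facets. -/
def HasContractibleHamiltonianCycle [DecidableEq V] : Prop :=
  ∃ (a : V) (w : K.graph.Walk a a), w.IsHamiltonianCycle ∧
    ∃ D : Set K.facets, K.BoundsDisc w.toSubgraph D

/-- Proper trees in the edge graph of the dual. -/
structure IsProperTree (T : K.dualGraph.Subgraph) : Prop where
  isTree : T.coe.IsTree
  /-- The degrees, in the edge graph of the dual, of the `k` vertices of the tree sum up to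
  `n + 2 (k - 1)`, where `n` is the number of vertices of the map (and `k ≥ 1` for a tree). -/
  degree_sum : ∑ᶠ f ∈ T.verts, (K.dualGraph.neighborSet f).ncard =
    Nat.card V + 2 * (T.verts.ncard - 1)
  /-- Two vertices of the tree on a common face of the dual are joined by a path in the boundary
  of this face that belongs to the tree. -/
  path_mem : ∀ (v : V) (f g : K.facets), f ∈ T.verts → g ∈ T.verts →
    f ∈ (K.dualFace v).verts → g ∈ (K.dualFace v).verts →
    ∃ p : K.dualGraph.Walk f g, p.IsPath ∧ p.toSubgraph ≤ K.dualFace v ∧ p.toSubgraph ≤ T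
  /-- A path of the tree in a face of the dual with boundary length `q` has length at most
  `q - 2`. -/
  path_length : ∀ (v : V) (f g : K.facets) (p : K.dualGraph.Walk f g), p.IsPath →
    p.toSubgraph ≤ T → p.toSubgraph ≤ K.dualFace v →
    p.length + 2 ≤ (K.dualFace v).edgeSet.ncard

end PolygonalComplex

/-! From a tree to a cycle. The facets of a proper tree are glued one at a time along the edges dual
to the tree edges. Suppose that a new facet `f`, attached to `g`, shares a vertex `w` with a facet
`j` already present. The path around `w` supplied by `path_mem` must be the tree path from `f` to
`j`; it begins with the edge `fg`, so `w` lies on the edge common to `f` and `g`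
(`IsProperTree.mem_of_mem`). The new facet therefore meets the earlier ones in a single edge: the
union remains a disc with all its vertices on the boundary, and its boundary length is the sum of
the facet sizes minus 2 per gluing. The degree sum condition makes this length `n`, so the boundary
is a Hamiltonian cycle.

That the union is a disc is shown by an explicit drawing. Vertices are placed on a parabola, in the
order of the boundary list, and facet centres at barycentres; the drawing extends linearly. Points
of a parabola are always in convex position, so every stage fills a convex polygon, and gluing
amounts to cutting a polygon by a chord (`isPlanar_singleton`, `IsPlanar.union`). Since `IsPlanar`
quantifies over all increasing parameters, one choice of parameters serves both pieces. A planar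
polygon is then carried to the round disc by a homeomorphism for convex bodies
(`IsPlanar.boundsDisc`).

From a cycle to a tree. Let `D` be the set of facets of the disc; the tree is the subgraph of the
dual induced on `D`. Topology of the disc shows that a boundary edge lies in exactly one facet of
`D` and any other edge of such a facet in two (`BoundsDisc.eq_of_adj`, `exists_adj`,
`exists_other`). The interior is connected and contains no vertex, so `D` is connected through
common edges (`exists_adj_of_partition`). A nowhere zero function on the interior has a logarithm;
applied to a function winding around the origin across one edge, this shows that each dual edge is a
bridge (`exists_potential`). The degree sum is a count of edges, and the two face conditions hold
because the cycle has exactly two edges at each vertex. -/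

/-! ### Polygons as cyclic lists, and splicing them along a side. -/

/-- `l.Consec a b` says that `a` is immediately followed by `b` in the list `l`. -/
def List.Consec {α : Type*} : List α → α → α → Prop
  | x :: y :: l, a, b => (a = x ∧ b = y) ∨ List.Consec (y :: l) a b
  | _, _, _ => False

/-- `a` is the first and `b` is the last entry of `l`. -/
def List.Ends {α : Type*} (l : List α) (a b : α) : Prop :=
  l.head? = some a ∧ l.getLast? = some b

/-- The undirected adjacency relation of the polygon with the cyclic vertex list `l`. -/
def List.PolyAdj {α : Type*} (l : List α) (a b : α) : Prop :=
  (l.Consec a b ∨ l.Ends a b) ∨ (l.Consec b a ∨ l.Ends b a)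

namespace List

variable {α : Type*}

@[simp] lemma consec_nil (a b : α) : ¬ ([] : List α).Consec a b := fun h => h

@[simp] lemma consec_singleton (x a b : α) : ¬ [x].Consec a b := fun h => h

@[simp] lemma consec_cons_cons (x y : α) (l : List α) (a b : α) :
    (x :: y :: l).Consec a b ↔ (a = x ∧ b = y) ∨ (y :: l).Consec a b := Iff.rfl

lemma consec_append_cons (l₁ : List α) (x : α) (l₂ : List α) (a b : α) :
    (l₁ ++ x :: l₂).Consec a b ↔ (l₁ ++ [x]).Consec a b ∨ (x :: l₂).Consec a b := by
  induction l₁ with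
  | nil => simp
  | cons y l ih =>
    cases l with
    | nil => simp
    | cons z l =>
      simp only [cons_append, consec_cons_cons, or_assoc] at ih ⊢
      rw [ih]

lemma consec_reverse (l : List α) (a b : α) : l.reverse.Consec a b ↔ l.Consec b a := by
  induction l with
  | nil => simp
  | cons x l ih =>
    cases l with
    | nil => simp
    | cons y l =>
      rw [consec_cons_cons, ← ih]
      simp only [reverse_cons, append_assoc, cons_append, nil_append]
      rw [consec_append_cons]
      simp
      tauto

lemma Consec.mem_left {l : List α} {a b : α} (h : l.Consec a b) : a ∈ l := by
  induction l with
  | nil => simp at h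
  | cons x l ih =>
    cases l with
    | nil => simp at h
    | cons y l => rcases h with ⟨rfl, rfl⟩ | h <;> simp_all

lemma Consec.mem_right {l : List α} {a b : α} (h : l.Consec a b) : b ∈ l := by
  rw [← consec_reverse] at h
  simpa using h.mem_left

lemma Consec.exists_append {l : List α} {a b : α} (h : l.Consec a b) :
    ∃ l₁ l₂, l = l₁ ++ a :: b :: l₂ := by
  induction l with
  | nil => simp at h
  | cons x l ih =>
    cases l with
    | nil => simp at h
    | cons y l =>
      rcases h with ⟨rfl, rfl⟩ | h
      · exact ⟨[], l, rfl⟩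
      · obtain ⟨l₁, l₂, h⟩ := ih h
        exact ⟨x :: l₁, l₂, by simp [h]⟩

lemma consec_append_pair (l₁ l₂ : List α) (a b : α) : (l₁ ++ a :: b :: l₂).Consec a b := by
  rw [consec_append_cons]; simp

lemma Ends.exists_eq {l : List α} {a b : α} (h : l.Ends a b) (hl : 2 ≤ l.length) :
    ∃ m, l = a :: (m ++ [b]) := by
  cases l with
  | nil => simp at hl
  | cons x l =>
    obtain ⟨h₁, h₂⟩ := h
    simp only [head?_cons, Option.some.injEq] at h₁
    subst h₁
    rcases eq_nil_or_concat l with rfl | ⟨m, c, rfl⟩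
    · simp at hl
    · refine ⟨m, ?_⟩
      rw [concat_eq_append, getLast?_cons, getLast?_append] at h₂
      simp at h₂
      simp [h₂]

@[simp] lemma ends_cons_append_singleton (u v : α) (m : List α) (a b : α) :
    (u :: (m ++ [v])).Ends a b ↔ a = u ∧ b = v := by
  simp [Ends, getLast?_cons, getLast?_append, eq_comm]

lemma consec_append_cons_cons (l₁ : List α) (u v : α) (l₂ : List α) (a b : α) :
    (l₁ ++ u :: v :: l₂).Consec a b ↔
      (l₁ ++ [u]).Consec a b ∨ (a = u ∧ b = v) ∨ (v :: l₂).Consec a b := by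
  rw [consec_append_cons, consec_cons_cons]

lemma consec_splice (l₁ : List α) (u : α) (m : List α) (v : α) (l₂ : List α) (a b : α) :
    (l₁ ++ u :: (m ++ v :: l₂)).Consec a b ↔
      (l₁ ++ [u]).Consec a b ∨ (u :: (m ++ [v])).Consec a b ∨ (v :: l₂).Consec a b := by
  have := consec_append_cons (u :: m) v l₂ a b
  rw [consec_append_cons, ← cons_append, this, cons_append]

lemma ends_splice (l₁ : List α) (u : α) (m : List α) (v : α) (l₂ : List α) (a b : α) :
    (l₁ ++ u :: (m ++ v :: l₂)).Ends a b ↔ (l₁ ++ u :: v :: l₂).Ends a b := by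
  simp [Ends, getLast?_append, getLast?_cons]

lemma Ends.mem_left {l : List α} {a b : α} (h : l.Ends a b) : a ∈ l :=
  mem_of_mem_head? h.1

lemma Ends.mem_right {l : List α} {a b : α} (h : l.Ends a b) : b ∈ l :=
  mem_of_mem_getLast? h.2

/-- This and the next two lemmas describe the boundary after gluing two polygons along `uv`, which
is a pair of consecutive entries in one list and the pair of ends in the other. Every side survives
except possibly `uv` itself. -/
lemma PolyAdj.of_splice {l₁ m l₂ : List α} {u v a b : α}
    (h : (l₁ ++ u :: (m ++ v :: l₂)).PolyAdj a b) :
    (l₁ ++ u :: v :: l₂).PolyAdj a b ∨ (u :: (m ++ [v])).PolyAdj a b := by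
  simp only [PolyAdj, consec_splice, ends_splice, consec_append_cons_cons] at h ⊢
  tauto

lemma PolyAdj.splice_left {l₁ m l₂ : List α} {u v a b : α}
    (h : (l₁ ++ u :: v :: l₂).PolyAdj a b) (hne : s(a, b) ≠ s(u, v)) :
    (l₁ ++ u :: (m ++ v :: l₂)).PolyAdj a b := by
  rw [Ne, Sym2.eq_iff] at hne
  simp only [PolyAdj, consec_splice, ends_splice, consec_append_cons_cons] at h ⊢
  tauto

lemma PolyAdj.splice_right {l₁ m l₂ : List α} {u v a b : α}
    (h : (u :: (m ++ [v])).PolyAdj a b) (hne : s(a, b) ≠ s(u, v)) :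
    (l₁ ++ u :: (m ++ v :: l₂)).PolyAdj a b := by
  rw [Ne, Sym2.eq_iff] at hne
  simp only [PolyAdj, consec_splice, ends_splice, ends_cons_append_singleton] at h ⊢
  tauto

/-- A change of listing that turns the closing side `uv` into a consecutive pair, so that another
polygon can be spliced in there. -/
lemma polyAdj_reverse_append (m : List α) (hm : m ≠ []) (u v a b : α) :
    (m.reverse ++ u :: v :: []).PolyAdj a b ↔ (u :: (m ++ [v])).PolyAdj a b := by
  obtain ⟨n, y, rfl⟩ : ∃ n y, m = n ++ [y] := by
    rcases eq_nil_or_concat m with h | ⟨n, c, h⟩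
    · exact absurd h hm
    · exact ⟨n, c, by simpa using h⟩
  have h1 : ∀ a b, (u :: (n ++ [y] ++ [v])).Consec a b ↔
      (u :: (n ++ [y])).Consec a b ∨ (a = y ∧ b = v) := fun a b => by
    have := consec_append_cons (u :: n) y [v] a b
    simpa using this
  have h2 : ∀ a b, ((n ++ [y]).reverse ++ u :: v :: []).Consec a b ↔
      (u :: (n ++ [y])).Consec b a ∨ (a = u ∧ b = v) := fun a b => by
    have := consec_reverse (u :: (n ++ [y])) a b
    rw [consec_append_cons_cons, ← this]
    simp
  have h3 : ∀ a b, ((n ++ [y]).reverse ++ u :: v :: []).Ends a b ↔ a = y ∧ b = v := fun a b => by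
    simp [Ends, getLast?_append, getLast?_cons, eq_comm]
  simp only [PolyAdj, h1, h2, h3, ends_cons_append_singleton]
  tauto

end List

/-! ### Cycle subgraphs and their listings. -/

namespace SimpleGraph

variable {V : Type*} {G : SimpleGraph V}

lemma Walk.consec_support_iff {u v : V} (p : G.Walk u v) (a b : V) :
    s(a, b) ∈ p.edges ↔ p.support.Consec a b ∨ p.support.Consec b a := by
  induction p with
  | nil => simp
  | @cons u w v h p ih =>
    obtain ⟨l, hl⟩ : ∃ l, p.support = w :: l := ⟨_, p.cons_tail_support.symm⟩
    simp only [Walk.edges_cons, List.mem_cons, Walk.support_cons, ih, hl, List.consec_cons_cons,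
      Sym2.eq_iff]
    tauto

/-- The list `l` runs once around the cycle `C`. -/
structure Subgraph.IsListing (C : G.Subgraph) (l : List V) : Prop where
  three_le : 3 ≤ l.length
  nodup : l.Nodup
  mem_iff : ∀ a, a ∈ l ↔ a ∈ C.verts
  adj_iff : ∀ a b, C.Adj a b ↔ l.PolyAdj a b

/-- A cycle without one of its edges is a path. -/
lemma Subgraph.IsCycleGraph.exists_path {C : G.Subgraph} (hC : C.IsCycleGraph) {u v : V}
    (huv : C.Adj u v) :
    ∃ p : G.Walk u v, p.IsPath ∧ 2 ≤ p.length ∧ s(u, v) ∉ p.edges ∧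
      (∀ a, a ∈ p.support ↔ a ∈ C.verts) ∧
      ∀ a b, C.Adj a b ↔ s(a, b) ∈ p.edges ∨ s(a, b) = s(u, v) := by
  classical
  obtain ⟨x, w, hw, rfl⟩ := hC
  have hu : u ∈ w.support := by
    rw [← Walk.mem_verts_toSubgraph]; exact huv.fst_mem
  obtain ⟨c, hc, hcw, hcv⟩ : ∃ c : G.Walk u u, c.IsCycle ∧ c.toSubgraph = w.toSubgraph ∧
      c.snd = v := by
    have h1 : (w.rotate u hu).IsCycle := (Walk.isCycle_rotate hu).mpr hw
    have h2 : (w.rotate u hu).toSubgraph = w.toSubgraph := w.toSubgraph_rotate hu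
    have h3 : v ∈ (w.rotate u hu).toSubgraph.neighborSet u := by rw [h2]; exact huv
    -- The rotated cycle has `v` as its second or its penultimate vertex; in the latter case it is
    -- reversed.
    rw [h1.neighborSet_toSubgraph_endpoint] at h3
    rcases h3 with h3 | h3
    · exact ⟨_, h1, h2, h3.symm⟩
    · refine ⟨_, h1.reverse, by rw [Walk.toSubgraph_reverse, h2], ?_⟩
      rw [Walk.snd, Walk.getVert_reverse]
      exact h3.symm
  rw [← hcw]
  cases c with
  | nil => simp at hc
  | cons h q =>
    simp only [Walk.snd_cons] at hcv
    subst hcv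
    have h3 := hc.three_le_length
    rw [Walk.cons_isCycle_iff] at hc
    refine ⟨q.reverse, hc.1.reverse, by simpa using h3, by simpa using hc.2, ?_, ?_⟩
    · intro a
      simp only [Walk.support_reverse, List.mem_reverse, Walk.mem_verts_toSubgraph,
        Walk.support_cons, List.mem_cons]
      constructor
      · exact Or.inr
      · rintro (rfl | h)
        · exact q.end_mem_support
        · exact h
    · intro a b
      rw [Walk.adj_toSubgraph_iff_mem_edges]
      simp [or_comm]

lemma Subgraph.IsCycleGraph.exists_isListing {C : G.Subgraph} (hC : C.IsCycleGraph) {u v : V}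
    (huv : C.Adj u v) : ∃ m : List V, C.IsListing (u :: (m ++ [v])) := by
  obtain ⟨p, hp, hlen, -, hv, he⟩ := hC.exists_path huv
  have hE : p.support.Ends u v := by
    constructor
    · rw [← p.cons_tail_support, List.head?_cons]
    · rw [List.getLast?_eq_some_getLast p.support_ne_nil, p.getLast_support]
  obtain ⟨m, hm⟩ := hE.exists_eq (by simp; omega)
  refine ⟨m, ?_, ?_, ?_, ?_⟩ <;> try rw [← hm]
  · simp; omega
  · exact hp.support_nodup
  · exact hv
  · intro a b
    rw [he, Walk.consec_support_iff, List.PolyAdj]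
    have : ∀ a b, p.support.Ends a b ↔ a = u ∧ b = v := by
      intro a b; rw [hm]; simp
    rw [this, this, Sym2.eq_iff]
    tauto

lemma Subgraph.IsListing.reverse_append {C : G.Subgraph} {m : List V} {u v : V}
    (h : C.IsListing (u :: (m ++ [v]))) : C.IsListing (m.reverse ++ u :: v :: []) := by
  have hm : m ≠ [] := by rintro rfl; simpa using h.three_le
  have hperm : (m.reverse ++ u :: v :: []).Perm (u :: (m ++ [v])) := by
    refine List.perm_middle.trans ?_
    exact ((List.reverse_perm m).append_right _).cons u
  refine ⟨by simpa using h.three_le, hperm.nodup_iff.mpr h.nodup, fun a => ?_, fun a b => ?_⟩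
  · rw [hperm.mem_iff, h.mem_iff]
  · rw [h.adj_iff, List.polyAdj_reverse_append m hm]

lemma Subgraph.IsCycleGraph.exists_adj {C : G.Subgraph} (hC : C.IsCycleGraph) {u : V}
    (hu : u ∈ C.verts) : ∃ v, C.Adj u v := by
  obtain ⟨x, w, hw, rfl⟩ := hC
  rw [Walk.mem_verts_toSubgraph] at hu
  have := hw.ncard_neighborSet_toSubgraph_eq_two hu
  obtain ⟨v, hv⟩ := Set.nonempty_of_ncard_ne_zero (s := w.toSubgraph.neighborSet u) (by omega)
  exact ⟨v, hv⟩

lemma Subgraph.IsCycleGraph.nonempty {C : G.Subgraph} (hC : C.IsCycleGraph) :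
    ∃ u v, C.Adj u v := by
  obtain ⟨x, w, hw, rfl⟩ := hC
  exact ⟨x, _, w.toSubgraph_adj_snd hw.not_nil⟩

lemma Subgraph.IsCycleGraph.ncard_edgeSet {C : G.Subgraph} (hC : C.IsCycleGraph) :
    C.edgeSet.ncard = C.verts.ncard := by
  classical
  obtain ⟨x, w, hw, rfl⟩ := hC
  have h1 : w.toSubgraph.edgeSet = (w.edges.toFinset : Set (Sym2 V)) := by
    ext e; simp
  have h2 : w.toSubgraph.verts = (w.support.tail.toFinset : Set V) := by
    ext a
    simp only [Walk.mem_verts_toSubgraph, List.coe_toFinset, Set.mem_ofPred_eq]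
    rw [← w.cons_tail_support, List.mem_cons, List.tail_cons]
    constructor
    · rintro (rfl | h)
      · cases w with
        | nil => simp at hw
        | cons h p => simp
      · exact h
    · exact Or.inr
  rw [h1, h2, Set.ncard_coe_finset, Set.ncard_coe_finset,
    List.toFinset_card_of_nodup hw.edges_nodup, List.toFinset_card_of_nodup hw.support_nodup]
  simp

lemma Subgraph.IsListing.ncard_verts {C : G.Subgraph} {l : List V} (h : C.IsListing l) :
    C.verts.ncard = l.length := by
  classical
  have : C.verts = (l.toFinset : Set V) := by ext a; simp [h.mem_iff]
  rw [this, Set.ncard_coe_finset, List.toFinset_card_of_nodup h.nodup]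

end SimpleGraph

/-! ### Combinatorics of facets in a polyhedral map. -/

namespace PolygonalComplex

variable {V : Type*} {K : PolygonalComplex V}

lemma isCycleGraph (f : K.facets) : f.1.IsCycleGraph := K.facets_isCycle f.1 f.2

namespace IsPolyhedralMap

variable (hK : K.IsPolyhedralMap)
include hK

lemma exists_facets {u v : V} (h : K.graph.Adj u v) :
    ∃ f g : K.facets, f ≠ g ∧ f.1.Adj u v ∧ g.1.Adj u v ∧
      ∀ j : K.facets, j.1.Adj u v → j = f ∨ j = g := by
  obtain ⟨f, g, hne, hfg⟩ := Set.ncard_eq_two.mp (hK.edge_two_facets u v h)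
  have hf : f ∈ {f ∈ K.facets | f.Adj u v} := by rw [hfg]; simp
  have hg : g ∈ {f ∈ K.facets | f.Adj u v} := by rw [hfg]; simp
  refine ⟨⟨f, hf.1⟩, ⟨g, hg.1⟩, by simpa using hne, hf.2, hg.2, fun j hj => ?_⟩
  have : j.1 ∈ {f ∈ K.facets | f.Adj u v} := ⟨j.2, hj⟩
  rw [hfg] at this
  simpa [Subtype.ext_iff] using this

lemma exists_other {u v : V} {f : K.facets} (h : f.1.Adj u v) :
    ∃ g : K.facets, g ≠ f ∧ g.1.Adj u v := by
  obtain ⟨a, b, hab, ha, hb, hj⟩ := hK.exists_facets h.adj_sub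
  by_cases hf : a = f
  · exact ⟨b, fun h => hab (hf.trans h.symm), hb⟩
  · exact ⟨a, hf, ha⟩

lemma eq_or_eq {u v : V} {f g j : K.facets} (hfg : f ≠ g) (hf : f.1.Adj u v) (hg : g.1.Adj u v)
    (hj : j.1.Adj u v) : j = f ∨ j = g := by
  obtain ⟨a, b, hab, ha, hb, h⟩ := hK.exists_facets hf.adj_sub
  have := h f hf; have := h g hg; have := h j hj
  grind

lemma inf_eq {u v : V} {f g : K.facets} (hfg : f ≠ g) (hf : f.1.Adj u v) (hg : g.1.Adj u v) :
    f.1 ⊓ g.1 = K.graph.subgraphOfAdj hf.adj_sub := by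
  have hadj : (f.1 ⊓ g.1).Adj u v := ⟨hf, hg⟩
  rcases hK.facet_inter f.1 f.2 g.1 g.2 (fun h => hfg (Subtype.ext h)) with h | ⟨w, h⟩ | ⟨a, b, hab, h⟩
  · rw [h] at hadj; exact hadj.elim
  · rw [h] at hadj; exact hadj.elim
  · rw [h] at hadj ⊢
    rw [subgraphOfAdj_adj] at hadj
    rcases Sym2.eq_iff.mp hadj with ⟨rfl, rfl⟩ | ⟨rfl, rfl⟩
    · rfl
    · exact subgraphOfAdj_symm _

lemma mem_inter {u v w : V} {f g : K.facets} (hfg : f ≠ g) (hf : f.1.Adj u v) (hg : g.1.Adj u v)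
    (hwf : w ∈ f.1.verts) (hwg : w ∈ g.1.verts) : w = u ∨ w = v := by
  have : w ∈ (f.1 ⊓ g.1).verts := ⟨hwf, hwg⟩
  rw [hK.inf_eq hfg hf hg] at this
  simpa using this

lemma edge_unique {u v a b : V} {f g : K.facets} (hfg : f ≠ g) (hf : f.1.Adj u v)
    (hg : g.1.Adj u v) (hf' : f.1.Adj a b) (hg' : g.1.Adj a b) : s(a, b) = s(u, v) := by
  have : (f.1 ⊓ g.1).Adj a b := ⟨hf', hg'⟩
  rw [hK.inf_eq hfg hf hg, subgraphOfAdj_adj] at this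
  exact this.symm

/-- The degree of a facet in the dual graph is its number of edges. -/
lemma ncard_neighborSet (f : K.facets) :
    (K.dualGraph.neighborSet f).ncard = f.1.verts.ncard := by
  rw [← (isCycleGraph f).ncard_edgeSet]
  have hshare : ∀ g ∈ K.dualGraph.neighborSet f, ∃ e, e ∈ f.1.edgeSet ∧ e ∈ g.1.edgeSet := by
    rintro g ⟨-, u, v, hf, hg⟩
    exact ⟨s(u, v), hf, hg⟩
  -- Sending a neighbour to a shared edge is injective because an edge lies in only two facets, and
  -- surjective because two facets share at most one edge.
  choose φ hφf hφg using hshare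
  refine Set.ncard_congr φ hφf ?_ ?_
  · intro g g' hg hg' he
    have h1 := hφf g hg
    have h2 := hφg g hg
    have h3 := hφg g' hg'
    rw [← he] at h3
    revert h1 h2 h3
    induction φ g hg with
    | _ u v =>
      intro h1 h2 h3
      rcases hK.eq_or_eq hg.1 h1 h2 h3 with h | h
      · exact absurd h.symm hg'.1
      · exact h.symm
  · intro e he
    induction e with
    | _ u v =>
      obtain ⟨g, hg, hguv⟩ := hK.exists_other he
      have hadj : g ∈ K.dualGraph.neighborSet f := ⟨hg.symm, u, v, he, hguv⟩
      refine ⟨g, hadj, ?_⟩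
      have h1 := hφf g hadj
      have h2 := hφg g hadj
      revert h1 h2
      induction φ g hadj with
      | _ a b => exact fun h1 h2 => hK.edge_unique hg.symm he hguv h1 h2

end IsPolyhedralMap

end PolygonalComplex

/-! ### Polygons inscribed in a parabola -/

/-- The point of the parabola `y = x ^ 2` with first coordinate `a`. -/
def parabola (a : ℝ) : ℂ := ⟨a, a ^ 2⟩

/-- The affine function that vanishes on the line through `parabola a` and `parabola b`, and is
positive above this line. -/
def chord (a b : ℝ) (p : ℂ) : ℝ := p.im - (a + b) * p.re + a * b

/-- The sides of the polygon with vertex list `l`: consecutive entries form the lower sides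
(`σ = 1`), and the two ends form the upper side (`σ = -1`). -/
def List.IsSide {α : Type*} (l : List α) (σ : ℝ) (u v : α) : Prop :=
  (σ = 1 ∧ l.Consec u v) ∨ (σ = -1 ∧ l.Ends u v)

/-- The polygon inscribed in the parabola with vertices at the parameters `t v`, `v ∈ l`, where `t`
increases along `l`. -/
def inscribed {α : Type*} (t : α → ℝ) (l : List α) : Set ℂ :=
  {p | p.re ^ 2 ≤ p.im ∧ ∀ σ u v, l.IsSide σ u v → 0 ≤ σ * chord (t u) (t v) p}

/-- The factorisation reduces convex position to the order of the parameters. -/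
lemma chord_parabola (a b c : ℝ) : chord a b (parabola c) = (c - a) * (c - b) := by
  simp [chord, parabola]; ring

lemma chord_combo (a b : ℝ) {k m : ℝ} (h : k + m = 1) (p q : ℂ) :
    chord a b (k • p + m • q) = k * chord a b p + m * chord a b q := by
  obtain rfl : m = 1 - k := by linarith
  simp [chord]; ring

lemma chord_combo₃ (a b : ℝ) {k m n : ℝ} (h : k + m + n = 1) (p q r : ℂ) :
    chord a b (k • p + m • q + n • r) = k * chord a b p + m * chord a b q + n * chord a b r := by
  obtain rfl : n = 1 - k - m := by linarith
  simp [chord]; ring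

lemma continuous_chord (a b : ℝ) : Continuous (chord a b) := by
  unfold chord
  fun_prop

/-- The barycentre of finitely many points of the parabola. -/
noncomputable def barycentre {α : Type*} (t : α → ℝ) (s : Finset α) : ℂ :=
  ∑ w ∈ s, (s.card : ℝ)⁻¹ • parabola (t w)

lemma chord_barycentre {α : Type*} (t : α → ℝ) {s : Finset α} (hs : s.Nonempty) (a b : ℝ) :
    chord a b (barycentre t s) = (s.card : ℝ)⁻¹ * ∑ w ∈ s, (t w - a) * (t w - b) := by
  have hc : (s.card : ℝ) ≠ 0 := by simpa using hs.ne_empty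
  simp only [chord, barycentre, Complex.re_sum, Complex.im_sum, Complex.real_smul,
    Complex.re_ofReal_mul, Complex.im_ofReal_mul, parabola, ← Finset.mul_sum]
  have : ∑ w ∈ s, (t w - a) * (t w - b)
      = ∑ w ∈ s, t w ^ 2 - (a + b) * ∑ w ∈ s, t w + s.card * (a * b) := by
    rw [Finset.mul_sum, ← Finset.sum_sub_distrib, ← nsmul_eq_mul, ← Finset.sum_const,
      ← Finset.sum_add_distrib]
    exact Finset.sum_congr rfl fun w _ => by ring
  rw [this]
  field_simp

section Polygon

variable {α : Type*} {t : α → ℝ} {l : List α}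

lemma List.Consec.lt (hl : l.Pairwise (t · < t ·)) {u v : α} (h : l.Consec u v) : t u < t v := by
  obtain ⟨l₁, l₂, rfl⟩ := h.exists_append
  simp only [List.pairwise_append, List.pairwise_cons, List.mem_cons] at hl
  exact hl.2.1.1 v (Or.inl rfl)

lemma List.Consec.le_or_le (hl : l.Pairwise (t · < t ·)) {u v w : α} (h : l.Consec u v)
    (hw : w ∈ l) : t w ≤ t u ∨ t v ≤ t w := by
  obtain ⟨l₁, l₂, rfl⟩ := h.exists_append
  simp only [List.pairwise_append, List.pairwise_cons, List.mem_cons] at hl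
  simp only [List.mem_append, List.mem_cons] at hw
  rcases hw with hw | rfl | rfl | hw
  · exact Or.inl (hl.2.2 w hw u (Or.inl rfl)).le
  · exact Or.inl le_rfl
  · exact Or.inr le_rfl
  · exact Or.inr (hl.2.1.2.1 w hw).le

lemma List.Ends.le_and_le (hl : l.Pairwise (t · < t ·)) (h2 : 2 ≤ l.length) {u v w : α}
    (h : l.Ends u v) (hw : w ∈ l) : t u ≤ t w ∧ t w ≤ t v := by
  obtain ⟨m, rfl⟩ := h.exists_eq h2
  simp only [List.pairwise_append, List.pairwise_cons, List.mem_cons, List.mem_append,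
    List.not_mem_nil, or_false] at hl hw
  rcases hw with rfl | hw | rfl
  · exact ⟨le_rfl, (hl.1 v (Or.inr rfl)).le⟩
  · exact ⟨(hl.1 w (Or.inl hw)).le, (hl.2.2.2 w hw v rfl).le⟩
  · exact ⟨(hl.1 w (Or.inr rfl)).le, le_rfl⟩

lemma List.Ends.lt (hl : l.Pairwise (t · < t ·)) (h2 : 2 ≤ l.length) {u v : α}
    (h : l.Ends u v) : t u < t v := by
  obtain ⟨m, rfl⟩ := h.exists_eq h2
  simp only [List.pairwise_cons] at hl
  exact hl.1 v (by simp)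

lemma List.IsSide.lt (hl : l.Pairwise (t · < t ·)) (h2 : 2 ≤ l.length) {σ : ℝ} {u v : α}
    (h : l.IsSide σ u v) : t u < t v := by
  rcases h with ⟨-, h⟩ | ⟨-, h⟩
  · exact h.lt hl
  · exact h.lt hl h2

lemma List.IsSide.mem {σ : ℝ} {u v : α} (h : l.IsSide σ u v) : u ∈ l ∧ v ∈ l := by
  rcases h with ⟨-, h⟩ | ⟨-, h⟩
  · exact ⟨h.mem_left, h.mem_right⟩
  · exact ⟨h.mem_left, h.mem_right⟩

lemma List.polyAdj_iff_exists_isSide {u v : α} :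
    l.PolyAdj u v ↔ ∃ σ, l.IsSide σ u v ∨ l.IsSide σ v u := by
  constructor
  · rintro ((h | h) | (h | h))
    · exact ⟨1, Or.inl (Or.inl ⟨rfl, h⟩)⟩
    · exact ⟨-1, Or.inl (Or.inr ⟨rfl, h⟩)⟩
    · exact ⟨1, Or.inr (Or.inl ⟨rfl, h⟩)⟩
    · exact ⟨-1, Or.inr (Or.inr ⟨rfl, h⟩)⟩
  · rintro ⟨σ, (⟨-, h⟩ | ⟨-, h⟩) | (⟨-, h⟩ | ⟨-, h⟩)⟩
    · exact Or.inl (Or.inl h)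
    · exact Or.inl (Or.inr h)
    · exact Or.inr (Or.inl h)
    · exact Or.inr (Or.inr h)

lemma injOn_of_pairwise_lt (hl : l.Pairwise (t · < t ·)) {u v : α} (hu : u ∈ l) (hv : v ∈ l)
    (h : t u = t v) : u = v := by
  have hnd : (l.map t).Nodup := (List.pairwise_map.mpr hl).imp fun h => h.ne
  exact List.inj_on_of_nodup_map hnd hu hv h

/-- The vertices of the polygon lie on the inner side of each side. -/
lemma List.IsSide.vertex_nonneg (hl : l.Pairwise (t · < t ·)) (h2 : 2 ≤ l.length) {σ : ℝ}
    {u v w : α} (h : l.IsSide σ u v) (hw : w ∈ l) : 0 ≤ σ * ((t w - t u) * (t w - t v)) := by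
  have huv := h.lt hl h2
  rcases h with ⟨rfl, h⟩ | ⟨rfl, h⟩
  · rcases h.le_or_le hl hw with h | h
    · nlinarith
    · nlinarith
  · have := h.le_and_le hl h2 hw
    nlinarith

lemma List.IsSide.ne_zero {σ : ℝ} {u v : α} (h : l.IsSide σ u v) : σ ≠ 0 := by
  rcases h with ⟨rfl, -⟩ | ⟨rfl, -⟩ <;> norm_num

/-- Every vertex contributes a nonnegative term to the average, and a third vertex, off the side, a
positive one. -/
lemma List.IsSide.barycentre_pos (hl : l.Pairwise (t · < t ·)) (h3 : 3 ≤ l.length) {σ : ℝ}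
    {u v : α} (h : l.IsSide σ u v) {s : Finset α} (hs : ∀ w, w ∈ s ↔ w ∈ l) :
    0 < σ * chord (t u) (t v) (barycentre t s) := by
  classical
  have hsl : s = l.toFinset := by ext; simp [hs]
  have hnd : l.Nodup := hl.imp fun {a b} h hab => by rw [hab] at h; exact lt_irrefl _ h
  have hcard : 3 ≤ s.card := by rw [hsl, List.toFinset_card_of_nodup hnd]; exact h3
  obtain ⟨w, hw, hwu⟩ : ∃ w ∈ s, w ∉ ({u, v} : Finset α) := by
    by_contra! hcon
    have := Finset.card_le_card (show s ⊆ {u, v} from fun w hw => hcon w hw)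
    have := Finset.card_le_two (a := u) (b := v)
    omega
  simp only [Finset.mem_insert, Finset.mem_singleton, not_or] at hwu
  rw [chord_barycentre t ⟨w, hw⟩, mul_left_comm, Finset.mul_sum]
  refine mul_pos (by rw [inv_pos]; exact_mod_cast (by omega)) ?_
  refine Finset.sum_pos' (fun i hi => h.vertex_nonneg hl (by omega) ((hs i).mp hi)) ⟨w, hw, ?_⟩
  refine lt_of_le_of_ne (h.vertex_nonneg hl (by omega) ((hs w).mp hw)) (Ne.symm ?_)
  have h1 := fun e => hwu.1 (injOn_of_pairwise_lt hl ((hs w).mp hw) h.mem.1 e)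
  have h2 := fun e => hwu.2 (injOn_of_pairwise_lt hl ((hs w).mp hw) h.mem.2 e)
  exact mul_ne_zero h.ne_zero (mul_ne_zero (sub_ne_zero.mpr h1) (sub_ne_zero.mpr h2))

lemma exists_consec_between {u v : α} (hE : l.Ends u v) (h2 : 2 ≤ l.length) {x : ℝ}
    (hu : t u ≤ x) (hv : x ≤ t v) : ∃ a b, l.Consec a b ∧ t a ≤ x ∧ x ≤ t b := by
  induction l generalizing u with
  | nil => simp at h2
  | cons y l ih =>
    obtain ⟨h1, hl⟩ := hE
    simp only [List.head?_cons, Option.some.injEq] at h1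
    subst h1
    cases l with
    | nil => simp at h2
    | cons z l =>
      by_cases hz : x ≤ t z
      · exact ⟨y, z, by simp, hu, hz⟩
      · rw [List.getLast?_cons_cons] at hl
        cases l with
        | nil =>
          simp only [List.getLast?_singleton, Option.some.injEq] at hl
          exact absurd (hl ▸ hv) hz
        | cons w l =>
          obtain ⟨a, b, hab, h⟩ := ih (u := z) ⟨rfl, hl⟩ (by simp) (not_le.mp hz).le
          exact ⟨a, b, Or.inr hab, h⟩

/-- The upper side and the first and last lower sides have three different slopes. Their
inequalities alone confine the abscissa and determine a point from one-sided bounds. -/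
lemma exists_first_last (hl : l.Pairwise (t · < t ·)) (h3 : 3 ≤ l.length) :
    ∃ u w w' v, l.Ends u v ∧ l.Consec u w ∧ l.Consec w' v ∧ t w < t v ∧ t u < t w' := by
  obtain ⟨u, m, v, rfl⟩ : ∃ u m v, l = u :: (m ++ [v]) := by
    cases l with
    | nil => simp at h3
    | cons u l =>
      rcases List.eq_nil_or_concat l with rfl | ⟨m, c, rfl⟩
      · simp at h3
      · exact ⟨u, m, c, by simp⟩
  obtain ⟨w, m', rfl⟩ : ∃ w m', m = w :: m' := by
    cases m with
    | nil => simp at h3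
    | cons w m' => exact ⟨w, m', rfl⟩
  obtain ⟨m'', w', hm⟩ : ∃ m'' w', w :: m' = m'' ++ [w'] := by
    rcases List.eq_nil_or_concat (w :: m') with h | ⟨m, c, h⟩
    · simp at h
    · exact ⟨m, c, by simpa using h⟩
  refine ⟨u, w, w', v, (List.ends_cons_append_singleton ..).mpr ⟨rfl, rfl⟩, by simp, ?_, ?_, ?_⟩
  · rw [hm]
    simpa using List.consec_append_pair (u :: m'') [] w' v
  · simp only [List.cons_append, List.pairwise_cons] at hl
    exact hl.2.1 v (by simp)
  · rw [hm] at hl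
    simp only [List.pairwise_cons] at hl
    exact hl.1 w' (by simp)

/-- The inequalities for the sides imply that the polygon lies above the parabola. -/
lemma mem_inscribed_of_sides (hl : l.Pairwise (t · < t ·)) (h3 : 3 ≤ l.length) {p : ℂ}
    (hp : ∀ σ u v, l.IsSide σ u v → 0 ≤ σ * chord (t u) (t v) p) : p ∈ inscribed t l := by
  refine ⟨?_, hp⟩
  obtain ⟨u, w, w', v, hE, huw, hwv', hwv, huw'⟩ := exists_first_last hl h3
  have htop := hp (-1) u v (Or.inr ⟨rfl, hE⟩)
  have hfirst := hp 1 u w (Or.inl ⟨rfl, huw⟩)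
  have hlast := hp 1 w' v (Or.inl ⟨rfl, hwv'⟩)
  simp only [chord] at htop hfirst hlast
  -- Adding the upper inequality to the first lower one gives `0 ≤ (t v - t w) * (p.re - t u)`; the
  -- last lower side gives the other bound in the same way.
  have h1 : t u ≤ p.re := by nlinarith
  have h2 : p.re ≤ t v := by nlinarith
  obtain ⟨a, b, hab, ha, hb⟩ := exists_consec_between hE (by omega) h1 h2
  have := hp 1 a b (Or.inl ⟨rfl, hab⟩)
  simp only [chord] at this
  nlinarith

lemma parabola_mem_inscribed (hl : l.Pairwise (t · < t ·)) (h2 : 2 ≤ l.length) {w : α}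
    (hw : w ∈ l) : parabola (t w) ∈ inscribed t l := by
  refine ⟨le_rfl, fun σ u v h => ?_⟩
  rw [chord_parabola]
  exact h.vertex_nonneg hl h2 hw

lemma convex_inscribed (t : α → ℝ) (l : List α) : Convex ℝ (inscribed t l) := by
  rintro p ⟨hp, hp'⟩ q ⟨hq, hq'⟩ a b ha hb hab
  refine ⟨?_, fun σ u v h => ?_⟩
  · simp only [Complex.add_re, Complex.add_im, Complex.real_smul, Complex.re_ofReal_mul,
      Complex.im_ofReal_mul]
    obtain rfl : b = 1 - a := by linarith
    nlinarith [mul_nonneg (mul_nonneg ha hb) (sq_nonneg (p.re - q.re))]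
  · rw [chord_combo _ _ hab]
    nlinarith [mul_nonneg ha (hp' σ u v h), mul_nonneg hb (hq' σ u v h)]

/-- On the line where the chord function vanishes, the parabola inequality reads `0 ≤ (p.re - a) *
(b - p.re)`, which cuts out exactly the chord. This is the use of keeping that inequality in
`inscribed`. -/
lemma mem_segment_of_chord_eq_zero {a b : ℝ} (hab : a < b) {p : ℂ} (hp : p.re ^ 2 ≤ p.im)
    (h : chord a b p = 0) : p ∈ segment ℝ (parabola a) (parabola b) := by
  simp only [chord] at h
  have h1 : 0 ≤ (p.re - a) * (b - p.re) := by nlinarith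
  have ha : a ≤ p.re := by nlinarith
  have hb : p.re ≤ b := by nlinarith
  have hd : 0 < b - a := by linarith
  refine ⟨(b - p.re) / (b - a), (p.re - a) / (b - a), by apply div_nonneg <;> linarith,
    by apply div_nonneg <;> linarith, by field_simp; ring, ?_⟩
  apply Complex.ext
  · simp only [parabola, Complex.add_re, Complex.real_smul, Complex.re_ofReal_mul]
    field_simp; ring
  · simp only [parabola, Complex.add_im, Complex.real_smul, Complex.im_ofReal_mul]
    have : p.im = (a + b) * p.re - a * b := by linarith
    rw [this]
    field_simp; ring

lemma chord_eq_zero_of_mem_segment {a b : ℝ} {p : ℂ}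
    (h : p ∈ segment ℝ (parabola a) (parabola b)) : chord a b p = 0 := by
  obtain ⟨k, m, -, -, hkm, rfl⟩ := h
  rw [chord_combo _ _ hkm, chord_parabola, chord_parabola]
  ring

lemma finite_isSide [Finite α] (l : List α) :
    {e : ℝ × α × α | l.IsSide e.1 e.2.1 e.2.2}.Finite := by
  refine ((Set.toFinite ({1, -1} : Set ℝ)).prod (Set.finite_univ (α := α × α))).subset ?_
  rintro ⟨σ, u, v⟩ h
  rcases h with ⟨rfl, -⟩ | ⟨rfl, -⟩ <;> simp

lemma exists_isSide (h1 : l ≠ []) : ∃ σ u v, l.IsSide σ u v :=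
  ⟨-1, l.head h1, l.getLast h1, Or.inr ⟨rfl, List.head?_eq_some_head h1,
    List.getLast?_eq_some_getLast h1⟩⟩

lemma isClosed_inscribed (t : α → ℝ) (l : List α) : IsClosed (inscribed t l) := by
  have : inscribed t l = {p | p.re ^ 2 ≤ p.im} ∩
      ⋂ (σ) (u) (v) (_ : l.IsSide σ u v), {p | 0 ≤ σ * chord (t u) (t v) p} := by
    ext p; simp [inscribed]
  rw [this]
  refine (isClosed_le (by fun_prop) (by fun_prop)).inter ?_
  refine isClosed_iInter fun σ => isClosed_iInter fun u => isClosed_iInter fun v =>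
    isClosed_iInter fun _ => isClosed_le continuous_const
      (continuous_const.mul (continuous_chord _ _))

lemma mem_interior_inscribed [Finite α] (hl : l.Pairwise (t · < t ·)) (h3 : 3 ≤ l.length) {p : ℂ}
    (hp : ∀ σ u v, l.IsSide σ u v → 0 < σ * chord (t u) (t v) p) :
    p ∈ interior (inscribed t l) := by
  let U : Set ℂ := ⋂ e ∈ {e : ℝ × α × α | l.IsSide e.1 e.2.1 e.2.2},
    {p | 0 < e.1 * chord (t e.2.1) (t e.2.2) p}
  have hU : IsOpen U := (finite_isSide l).isOpen_biInter fun e _ =>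
    isOpen_lt continuous_const (continuous_const.mul (continuous_chord _ _))
  refine mem_interior.mpr ⟨U, fun q hq => ?_, hU, ?_⟩
  · refine mem_inscribed_of_sides hl h3 fun σ u v h => ?_
    have := Set.mem_iInter₂.mp hq (σ, u, v) h
    exact le_of_lt this
  · exact Set.mem_iInter₂.mpr fun e he => hp e.1 e.2.1 e.2.2 he

lemma mem_frontier_inscribed [Finite α] (hl : l.Pairwise (t · < t ·)) (h3 : 3 ≤ l.length) {p : ℂ}
    (hp : p ∈ inscribed t l) :
    p ∈ frontier (inscribed t l) ↔ ∃ σ u v, l.IsSide σ u v ∧ chord (t u) (t v) p = 0 := by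
  rw [(isClosed_inscribed t l).frontier_eq]
  constructor
  · rintro ⟨-, hint⟩
    by_contra! hcon
    refine hint (mem_interior_inscribed hl h3 fun σ u v h => ?_)
    exact lt_of_le_of_ne (hp.2 σ u v h) (mul_ne_zero h.ne_zero (hcon σ u v h)).symm
  · rintro ⟨σ, u, v, h, h0⟩
    refine ⟨hp, fun hint => ?_⟩
    rw [mem_interior_iff_mem_nhds] at hint
    -- A vertical shift by `-ε * σ` changes `σ * chord` by `-ε * σ ^ 2`, so points arbitrarily near
    -- `p` violate the inequality of this side.
    have hcont : Filter.Tendsto (fun ε : ℝ => p + (-ε * σ : ℝ) • Complex.I) (nhds 0) (nhds p) := by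
      have : Continuous fun ε : ℝ => p + (-ε * σ : ℝ) • Complex.I := by fun_prop
      simpa using this.tendsto 0
    obtain ⟨ε, hε, hε0⟩ := (((hcont.eventually hint).filter_mono nhdsWithin_le_nhds).and
      (self_mem_nhdsWithin (s := Set.Ioi (0 : ℝ)))).exists
    have := hε.2 σ u v h
    have h2 : chord (t u) (t v) (p + (-ε * σ : ℝ) • Complex.I) = -ε * σ := by
      simp only [chord] at h0 ⊢
      simp
      linarith
    rw [h2] at this
    have hσ : 0 < σ * σ := mul_self_pos.mpr h.ne_zero
    nlinarith [mul_pos (Set.mem_Ioi.mp hε0) hσ]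

/-- A point with larger distances to all sides than another point coincides with it. -/
lemma eq_of_chord_le (hl : l.Pairwise (t · < t ·)) (h3 : 3 ≤ l.length) {p q : ℂ}
    (h : ∀ σ u v, l.IsSide σ u v → σ * chord (t u) (t v) q ≤ σ * chord (t u) (t v) p) : p = q := by
  obtain ⟨u, w, w', v, hE, huw, hwv', hwv, huw'⟩ := exists_first_last hl h3
  have htop := h (-1) u v (Or.inr ⟨rfl, hE⟩)
  have hfirst := h 1 u w (Or.inl ⟨rfl, huw⟩)
  have hlast := h 1 w' v (Or.inl ⟨rfl, hwv'⟩)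
  simp only [chord] at htop hfirst hlast
  have h1 : p.re = q.re := by
    apply le_antisymm <;> nlinarith
  refine Complex.ext h1 ?_
  rw [h1] at htop hfirst
  apply le_antisymm <;> linarith

end Polygon

/-! ### Regions in barycentric coordinates, and their planar drawings. -/

namespace PolygonalComplex

variable {V : Type*} {K : PolygonalComplex V}

lemma mem_facetRegion_iff {f : K.facets} {x : V ⊕ K.facets → ℝ} :
    x ∈ K.facetRegion f ↔ ∃ (u v : V) (a b c : ℝ), f.1.Adj u v ∧ 0 ≤ a ∧ 0 ≤ b ∧ 0 ≤ c ∧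
      a + b + c = 1 ∧
      x = a • K.point (Sum.inl u) + b • K.point (Sum.inl v) + c • K.point (Sum.inr f) := by
  simp only [facetRegion, Set.mem_ofPred_eq]
  refine exists_congr fun u => exists_congr fun v => ?_
  rw [convexHull_insert (Set.insert_nonempty _ _), convexHull_pair, mem_convexJoin]
  constructor
  · rintro ⟨h, p, hp, y, ⟨b, c, hb, hc, hbc, rfl⟩, ⟨k, m, hk, hm, hkm, rfl⟩⟩
    rw [Set.mem_singleton_iff] at hp
    subst hp
    refine ⟨k, m * b, m * c, h, hk, by positivity, by positivity, ?_, ?_⟩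
    · rw [add_assoc, ← mul_add, hbc, mul_one, hkm]
    · rw [smul_add, smul_smul, smul_smul, add_assoc]
  · rintro ⟨a, b, c, h, ha, hb, hc, habc, rfl⟩
    refine ⟨h, _, rfl, ?_⟩
    by_cases h0 : b + c = 0
    · have hb0 : b = 0 := by linarith
      have hc0 : c = 0 := by linarith
      have ha1 : a = 1 := by linarith
      subst hb0 hc0 ha1
      exact ⟨K.point (Sum.inl v), left_mem_segment _ _ _, by simpa using left_mem_segment _ _ _⟩
    · have hpos : 0 < b + c := lt_of_le_of_ne (by positivity) (Ne.symm h0)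
      refine ⟨(b / (b + c)) • K.point (Sum.inl v) + (c / (b + c)) • K.point (Sum.inr f),
        ⟨_, _, by positivity, by positivity, by field_simp, rfl⟩,
        a, b + c, ha, hpos.le, by linarith, ?_⟩
      rw [smul_add, smul_smul, smul_smul, add_assoc]
      congr 3 <;> field_simp

lemma mem_region_iff {D : Set K.facets} {x : V ⊕ K.facets → ℝ} :
    x ∈ K.region D ↔ ∃ f ∈ D, x ∈ K.facetRegion f := by
  simp [region]

lemma segment_subset_facetRegion {f : K.facets} {u v : V} (h : f.1.Adj u v) :
    segment ℝ (K.point (Sum.inl u)) (K.point (Sum.inl v)) ⊆ K.facetRegion f := by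
  rintro x ⟨a, b, ha, hb, hab, rfl⟩
  exact mem_facetRegion_iff.mpr ⟨u, v, a, b, 0, h, ha, hb, le_rfl, by linarith, by simp⟩

lemma facetRegion_subset_region {f : K.facets} {D : Set K.facets} (h : f ∈ D) :
    K.facetRegion f ⊆ K.region D := fun _ hx => mem_region_iff.mpr ⟨f, h, hx⟩

lemma centre_mem_facetRegion (f : K.facets) : K.point (Sum.inr f) ∈ K.facetRegion f := by
  obtain ⟨u, v, h⟩ := (isCycleGraph f).nonempty
  exact mem_facetRegion_iff.mpr ⟨u, v, 0, 0, 1, h, le_rfl, le_rfl, zero_le_one, by simp, by simp⟩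

lemma isCompact_facetRegion [Finite V] (f : K.facets) : IsCompact (K.facetRegion f) := by
  have : K.facetRegion f = ⋃ e ∈ {e : V × V | f.1.Adj e.1 e.2},
      convexHull ℝ {K.point (Sum.inl e.1), K.point (Sum.inl e.2), K.point (Sum.inr f)} := by
    ext x; simp [facetRegion]
  rw [this]
  exact (Set.toFinite _).isCompact_biUnion fun e _ => (Set.toFinite _).isCompact_convexHull ℝ

lemma isCompact_region [Finite V] (D : Set K.facets) : IsCompact (K.region D) :=
  (Set.toFinite D).isCompact_biUnion fun f _ => isCompact_facetRegion f

lemma barycentre_mem_inscribed {t : V → ℝ} {l : List V} (hl : l.Pairwise (t · < t ·))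
    (h2 : 2 ≤ l.length) {s : Finset V} (hs : ∀ w, w ∈ s ↔ w ∈ l) :
    barycentre t s ∈ inscribed t l := by
  have hne : s.Nonempty := ⟨l.head (by rintro rfl; simp at h2), (hs _).mpr (List.head_mem _)⟩
  refine (convex_inscribed t l).sum_mem (fun _ _ => by positivity) ?_
    fun i hi => parabola_mem_inscribed hl h2 ((hs i).mp hi)
  rw [Finset.sum_const, nsmul_eq_mul, mul_inv_cancel₀ (by exact_mod_cast hne.card_ne_zero)]

/-! ### Planar drawings -/

section Drawing

variable [Finite V]

/-- The position of a vertex, or of the centre of a facet, in the drawing with parameters `t`. -/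
noncomputable def position (K : PolygonalComplex V) (t : V → ℝ) : V ⊕ K.facets → ℂ
  | Sum.inl v => parabola (t v)
  | Sum.inr f => barycentre t f.1.verts.toFinite.toFinset

/-- The drawing of the complex in the plane with vertices on a parabola, at the parameters `t`. -/
noncomputable def drawing (K : PolygonalComplex V) (t : V → ℝ) : (V ⊕ K.facets → ℝ) →ₗ[ℝ] ℂ :=
  letI := Fintype.ofFinite (V ⊕ K.facets)
  Fintype.linearCombination ℝ (K.position t)

lemma drawing_point (t : V → ℝ) (i : V ⊕ K.facets) :
    K.drawing t (K.point i) = K.position t i := by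
  classical
  let := Fintype.ofFinite (V ⊕ K.facets)
  unfold drawing point
  convert Fintype.linearCombination_apply_single ℝ (v := K.position t) i 1 using 2
  simp

lemma continuous_drawing (t : V → ℝ) : Continuous (K.drawing t) :=
  LinearMap.continuous_of_finiteDimensional _

/-- The facets in `D` are drawn without overlaps and fill the polygon with vertex list `l`. -/
def IsPlanar (K : PolygonalComplex V) (D : Set K.facets) (l : List V) : Prop :=
  ∀ t : V → ℝ, l.Pairwise (t · < t ·) →
    Set.InjOn (K.drawing t) (K.region D) ∧ K.drawing t '' K.region D = inscribed t l

lemma drawing_mem_inscribed {f : K.facets} {l : List V} (hf : f.1.IsListing l) {t : V → ℝ}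
    (hl : l.Pairwise (t · < t ·)) {x : V ⊕ K.facets → ℝ} (hx : x ∈ K.facetRegion f) :
    K.drawing t x ∈ inscribed t l := by
  have h2 : 2 ≤ l.length := by have := hf.three_le; omega
  obtain ⟨u, v, a, b, c, huv, ha, hb, hc, habc, rfl⟩ := mem_facetRegion_iff.mp hx
  simp only [map_add, map_smul, drawing_point, position]
  have hu := parabola_mem_inscribed hl h2 ((hf.mem_iff u).mpr huv.fst_mem)
  have hv := parabola_mem_inscribed hl h2 ((hf.mem_iff v).mpr huv.snd_mem)
  have hm := barycentre_mem_inscribed hl h2 (s := f.1.verts.toFinite.toFinset)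
    (fun w => by simp [hf.mem_iff])
  refine mem_inscribed_of_sides hl hf.three_le fun σ p q h => ?_
  rw [chord_combo₃ _ _ habc]
  nlinarith [mul_nonneg ha (hu.2 σ p q h), mul_nonneg hb (hv.2 σ p q h),
    mul_nonneg hc (hm.2 σ p q h)]

/-- The chord function of the side `uv` vanishes at `u` and `v` and has the right sign on the rest
of the polygon. Evaluating it at two points with the same image bounds one centre weight by the
other, and by symmetry the weights agree. The second point then has no weight at vertices off `uv`,
and comparing abscissas finishes the proof. -/
lemma injOn_drawing_facetRegion {f : K.facets} {l : List V} (hf : f.1.IsListing l) {t : V → ℝ}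
    (hl : l.Pairwise (t · < t ·)) : Set.InjOn (K.drawing t) (K.facetRegion f) := by
  have h2 : 2 ≤ l.length := by have := hf.three_le; omega
  set B := barycentre t f.1.verts.toFinite.toFinset with hB
  -- `chord` is symmetric in its endpoints, so one sign `σ` serves both orientations of the edge.
  have side : ∀ u v, f.1.Adj u v → ∃ σ : ℝ, 0 < σ * chord (t u) (t v) B ∧
      ∀ w ∈ f.1.verts, 0 ≤ σ * ((t w - t u) * (t w - t v)) := by
    intro u v huv
    rw [hf.adj_iff, List.polyAdj_iff_exists_isSide] at huv
    obtain ⟨σ, h | h⟩ := huv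
    · exact ⟨σ, h.barycentre_pos hl hf.three_le (by simp [hf.mem_iff]), fun w hw =>
        h.vertex_nonneg hl h2 ((hf.mem_iff w).mpr hw)⟩
    · refine ⟨σ, ?_, fun w hw => ?_⟩
      · have := h.barycentre_pos hl hf.three_le (s := f.1.verts.toFinite.toFinset)
          (by simp [hf.mem_iff])
        simpa [chord, add_comm, mul_comm, hB] using this
      · have := h.vertex_nonneg hl h2 ((hf.mem_iff w).mpr hw)
        linarith
  have key : ∀ u v a b c u' v' a' b' c', f.1.Adj u v → f.1.Adj u' v' →
      0 ≤ a' → 0 ≤ b' → a + b + c = 1 → a' + b' + c' = 1 →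
      a • parabola (t u) + b • parabola (t v) + c • B =
        a' • parabola (t u') + b' • parabola (t v') + c' • B →
      ∃ σ A A' : ℝ, 0 < σ * chord (t u) (t v) B ∧ A = σ * ((t u' - t u) * (t u' - t v)) ∧
        A' = σ * ((t v' - t u) * (t v' - t v)) ∧ 0 ≤ A ∧ 0 ≤ A' ∧
        c * (σ * chord (t u) (t v) B) = a' * A + b' * A' + c' * (σ * chord (t u) (t v) B) := by
    intro u v a b c u' v' a' b' c' huv huv' ha' hb' habc habc' h
    obtain ⟨σ, hσ, hσv⟩ := side u v huv
    refine ⟨σ, _, _, hσ, rfl, rfl, hσv u' huv'.fst_mem, hσv v' huv'.snd_mem, ?_⟩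
    have := congrArg (chord (t u) (t v)) h
    rw [chord_combo₃ _ _ habc, chord_combo₃ _ _ habc'] at this
    simp only [chord_parabola] at this
    linear_combination σ * this
  intro x hx x' hx' hxx'
  obtain ⟨u, v, a, b, c, huv, ha, hb, hc, habc, rfl⟩ := mem_facetRegion_iff.mp hx
  obtain ⟨u', v', a', b', c', huv', ha', hb', hc', habc', rfl⟩ := mem_facetRegion_iff.mp hx'
  simp only [map_add, map_smul, drawing_point, position, ← hB] at hxx'
  obtain ⟨σ, A, A', hM, hA, hA', hA0, hA0', h1⟩ :=
    key u v a b c u' v' a' b' c' huv huv' ha' hb' habc habc' hxx'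
  obtain ⟨σ', A₁, A₁', hM', -, -, hA₁0, hA₁0', h1'⟩ :=
    key u' v' a' b' c' u v a b c huv' huv ha hb habc' habc hxx'.symm
  obtain rfl : c = c' := by
    apply le_antisymm
    · have := mul_nonneg ha hA₁0
      have := mul_nonneg hb hA₁0'
      by_contra! hlt
      nlinarith
    · have := mul_nonneg ha' hA0
      have := mul_nonneg hb' hA0'
      by_contra! hlt
      nlinarith
  have hz : a' * A = 0 ∧ b' * A' = 0 := by
    have := mul_nonneg ha' hA0
    have := mul_nonneg hb' hA0'
    constructor <;> linarith
  have hσ : σ ≠ 0 := by rintro rfl; simp at hM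
  have inj : ∀ w w', w ∈ f.1.verts → w' ∈ f.1.verts → t w - t w' = 0 → w = w' :=
    fun w w' hw hw' h => injOn_of_pairwise_lt hl ((hf.mem_iff w).mpr hw) ((hf.mem_iff w').mpr hw')
      (sub_eq_zero.mp h)
  -- The line through two points of the parabola meets it nowhere else, so a vertex with nonzero
  -- weight at which the side function vanishes is `u` or `v`.
  have split : ∀ (k X : ℝ) (w : V), w ∈ f.1.verts → k * X = 0 →
      X = σ * ((t w - t u) * (t w - t v)) →
      ∃ α β : ℝ, k • K.point (Sum.inl w) = α • K.point (Sum.inl u) + β • K.point (Sum.inl v) ∧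
        α + β = k ∧ α * t u + β * t v = k * t w := by
    intro k X w hw h0 hX
    rw [hX] at h0
    rcases mul_eq_zero.mp h0 with h | h
    · exact ⟨0, 0, by simp [h], by simp [h], by simp [h]⟩
    rcases mul_eq_zero.mp ((mul_eq_zero.mp h).resolve_left hσ) with h | h
    · obtain rfl := inj w u hw huv.fst_mem h
      exact ⟨k, 0, by simp, by simp, by simp⟩
    · obtain rfl := inj w v hw huv.snd_mem h
      exact ⟨0, k, by simp, by simp, by simp⟩
  obtain ⟨α, β, hw, hαβ, hαβt⟩ := split a' A u' huv'.fst_mem hz.1 hA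
  obtain ⟨α', β', hw', hαβ', hαβt'⟩ := split b' A' v' huv'.snd_mem hz.2 hA'
  have hre := congrArg Complex.re hxx'
  simp only [Complex.add_re, Complex.real_smul, Complex.re_ofReal_mul, parabola] at hre
  have hne : t u - t v ≠ 0 := fun h => huv.ne (inj u v huv.fst_mem huv.snd_mem h)
  have e1 : a = α + α' := by
    have : (a - (α + α')) * (t u - t v) = 0 := by
      linear_combination hre - t v * (habc - habc') - hαβt - hαβt' + t v * hαβ + t v * hαβ'
    have := (mul_eq_zero.mp this).resolve_right hne
    linarith
  have e2 : b = β + β' := by linarith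
  rw [hw, hw', e1, e2]
  module

/-- A single facet is drawn as the polygon of its vertices. -/
lemma isPlanar_singleton {f : K.facets} {l : List V} (hf : f.1.IsListing l) :
    K.IsPlanar {f} l := by
  intro t hl
  have hreg : K.region {f} = K.facetRegion f := by simp [region]
  rw [hreg]
  refine ⟨injOn_drawing_facetRegion hf hl, ?_⟩
  apply Set.Subset.antisymm
  · rintro _ ⟨x, hx, rfl⟩
    exact drawing_mem_inscribed hf hl hx
  intro p hp
  have h3 := hf.three_le
  set B := barycentre t f.1.verts.toFinite.toFinset with hB
  have hpos : ∀ σ u v, l.IsSide σ u v → 0 < σ * chord (t u) (t v) B := fun σ u v h =>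
    h.barycentre_pos hl h3 (by simp [hf.mem_iff])
  obtain ⟨σ₀, u₀, v₀, h₀⟩ := exists_isSide (l := l) (by rintro rfl; simp at h3)
  -- Radial projection from the barycentre `B`: the side minimising the ratio of its function at `p`
  -- and at `B` is the one hit by the ray from `B` through `p`. With `s` the minimum, `p = s • B +
  -- (1 - s) • q` for a point `q` of that side, unless `p = B`.
  obtain ⟨⟨σ, u, v⟩, hside, hmin⟩ := Set.exists_min_image _
    (fun e : ℝ × V × V => (e.1 * chord (t e.2.1) (t e.2.2) p) / (e.1 * chord (t e.2.1) (t e.2.2) B))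
    (finite_isSide l) ⟨(σ₀, u₀, v₀), h₀⟩
  simp only [Set.mem_ofPred_eq] at hside hmin
  set s := (σ * chord (t u) (t v) p) / (σ * chord (t u) (t v) B) with hs
  have hs0 : 0 ≤ s := div_nonneg (hp.2 σ u v hside) (hpos σ u v hside).le
  have hle : ∀ σ u v, l.IsSide σ u v →
      s * (σ * chord (t u) (t v) B) ≤ σ * chord (t u) (t v) p := by
    intro σ' u' v' h
    exact (le_div_iff₀ (hpos σ' u' v' h)).mp (hmin (σ', u', v') h)
  have heq : s * (σ * chord (t u) (t v) B) = σ * chord (t u) (t v) p :=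
    div_mul_cancel₀ _ (hpos σ u v hside).ne'
  by_cases h1 : 1 ≤ s
  · have : p = B := eq_of_chord_le hl h3 fun σ' u' v' h => by
      have := hle σ' u' v' h
      have := hpos σ' u' v' h
      nlinarith
    exact ⟨_, centre_mem_facetRegion f, by rw [drawing_point, this]; rfl⟩
  rw [not_le] at h1
  have h1' : 0 < 1 - s := by linarith
  set q : ℂ := (1 - s)⁻¹ • p + (-s / (1 - s)) • B with hq
  have hcoef : (1 - s)⁻¹ + -s / (1 - s) = 1 := by field_simp; ring
  have hqmem : q ∈ inscribed t l := mem_inscribed_of_sides hl h3 fun σ' u' v' h => by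
    have : σ' * chord (t u') (t v') q = (1 - s)⁻¹ *
        (σ' * chord (t u') (t v') p - s * (σ' * chord (t u') (t v') B)) := by
      rw [hq, chord_combo _ _ hcoef]; field_simp; ring
    rw [this]
    exact mul_nonneg (by positivity) (sub_nonneg.mpr (hle σ' u' v' h))
  have hq0 : chord (t u) (t v) q = 0 := by
    have : σ * chord (t u) (t v) q = (1 - s)⁻¹ *
        (σ * chord (t u) (t v) p - s * (σ * chord (t u) (t v) B)) := by
      rw [hq, chord_combo _ _ hcoef]; field_simp; ring
    rw [heq, sub_self, mul_zero] at this
    exact (mul_eq_zero.mp this).resolve_left hside.ne_zero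
  obtain ⟨a, b, ha, hb, hab, habq⟩ :=
    mem_segment_of_chord_eq_zero (hside.lt hl (by omega)) hqmem.1 hq0
  have hadj : f.1.Adj u v := by
    rw [hf.adj_iff, List.polyAdj_iff_exists_isSide]; exact ⟨σ, Or.inl hside⟩
  refine ⟨_, mem_facetRegion_iff.mpr ⟨u, v, (1 - s) * a, (1 - s) * b, s, hadj, by positivity,
    by positivity, hs0, by rw [← mul_add, hab]; ring, rfl⟩, ?_⟩
  simp only [map_add, map_smul, drawing_point, position, ← hB, mul_smul]
  rw [← smul_add, habq, hq, smul_add, smul_smul, smul_smul, mul_inv_cancel₀ h1'.ne',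
    mul_div_cancel₀ _ h1'.ne']
  module

/-- Gluing two polygons along a side. -/
lemma IsPlanar.union {D₁ D₂ : Set K.facets} {l₁ l₂ m : List V} {u v : V}
    (h₁ : K.IsPlanar D₁ (l₁ ++ u :: v :: l₂)) (h₂ : K.IsPlanar D₂ (u :: (m ++ [v])))
    (hs₁ : segment ℝ (K.point (Sum.inl u)) (K.point (Sum.inl v)) ⊆ K.region D₁)
    (hs₂ : segment ℝ (K.point (Sum.inl u)) (K.point (Sum.inl v)) ⊆ K.region D₂) :
    K.IsPlanar (D₁ ∪ D₂) (l₁ ++ u :: (m ++ v :: l₂)) := by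
  intro t hl
  have hl1 : (l₁ ++ u :: v :: l₂).Pairwise (t · < t ·) := by
    refine hl.sublist ?_
    simp
  have hl2 : (u :: (m ++ [v])).Pairwise (t · < t ·) := by
    refine hl.sublist ?_
    refine List.Sublist.trans ?_ (List.sublist_append_right _ _)
    simp
  obtain ⟨hi1, him1⟩ := h₁ t hl1
  obtain ⟨hi2, him2⟩ := h₂ t hl2
  have hreg : K.region (D₁ ∪ D₂) = K.region D₁ ∪ K.region D₂ := by
    exact Set.biUnion_union D₁ D₂ _
  have huv : t u < t v := (List.consec_append_pair l₁ l₂ u v).lt hl1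
  have hc1 := List.consec_append_cons_cons l₁ u v l₂
  have hc := List.consec_splice l₁ u m v l₂
  have he := List.ends_splice l₁ u m v l₂
  -- The chord from `u` to `v` cuts the large polygon into the two small ones, according to the sign
  -- of `chord (t u) (t v)`.
  have hin : inscribed t (l₁ ++ u :: (m ++ v :: l₂)) =
      inscribed t (l₁ ++ u :: v :: l₂) ∪ inscribed t (u :: (m ++ [v])) := by
    apply Set.Subset.antisymm
    · intro p hp
      by_cases h0 : 0 ≤ chord (t u) (t v) p
      · refine Or.inl ⟨hp.1, ?_⟩
        rintro σ a b (⟨rfl, h⟩ | ⟨rfl, h⟩)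
        · rcases (hc1 a b).mp h with h | ⟨rfl, rfl⟩ | h
          · exact hp.2 1 a b (Or.inl ⟨rfl, (hc a b).mpr (Or.inl h)⟩)
          · linarith
          · exact hp.2 1 a b (Or.inl ⟨rfl, (hc a b).mpr (Or.inr (Or.inr h))⟩)
        · exact hp.2 (-1) a b (Or.inr ⟨rfl, (he a b).mpr h⟩)
      · refine Or.inr ⟨hp.1, ?_⟩
        rintro σ a b (⟨rfl, h⟩ | ⟨rfl, h⟩)
        · exact hp.2 1 a b (Or.inl ⟨rfl, (hc a b).mpr (Or.inr (Or.inl h))⟩)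
        · rw [List.ends_cons_append_singleton] at h
          obtain ⟨rfl, rfl⟩ := h
          linarith
    · rintro p (hp | hp)
      · refine ⟨hp.1, ?_⟩
        have h0 := hp.2 1 u v (Or.inl ⟨rfl, List.consec_append_pair _ _ _ _⟩)
        have hsq := hp.1
        rintro σ a b (⟨rfl, h⟩ | ⟨rfl, h⟩)
        · rcases (hc a b).mp h with h | h | h
          · exact hp.2 1 a b (Or.inl ⟨rfl, (hc1 a b).mpr (Or.inl h)⟩)
          · have h2 : 2 ≤ (u :: (m ++ [v])).length := by simp
            have hE : (u :: (m ++ [v])).Ends u v := by simp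
            have ha := hE.le_and_le hl2 h2 h.mem_left
            have hb := hE.le_and_le hl2 h2 h.mem_right
            have hab := h.lt hl2
            simp only [chord] at h0 ⊢
            -- Outside the interval from `t a` to `t b` the parabola inequality suffices; inside it
            -- the chord `uv` runs above the chord `ab`, and `p` lies above `uv`.
            rcases le_or_gt p.re (t a) with hx | hx
            · nlinarith
            rcases le_or_gt (t b) p.re with hx' | hx'
            · nlinarith
            nlinarith [mul_nonneg (sub_nonneg.mpr ha.1) (sub_nonneg.mpr hx'.le),
              mul_nonneg (sub_nonneg.mpr hb.2) (sub_nonneg.mpr hx.le),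
              mul_nonneg (sub_nonneg.mpr ha.1) (sub_nonneg.mpr hb.2)]
          · exact hp.2 1 a b (Or.inl ⟨rfl, (hc1 a b).mpr (Or.inr (Or.inr h))⟩)
        · exact hp.2 (-1) a b (Or.inr ⟨rfl, (he a b).mp h⟩)
      · refine ⟨hp.1, ?_⟩
        have h0 := hp.2 (-1) u v (Or.inr ⟨rfl, by simp⟩)
        have hsq := hp.1
        simp only [chord] at h0
        have hxu : t u ≤ p.re := by nlinarith
        have hxv : p.re ≤ t v := by nlinarith
        have hul : u ∈ l₁ ++ u :: v :: l₂ := by simp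
        have hvl : v ∈ l₁ ++ u :: v :: l₂ := by simp
        have h2 : 2 ≤ (l₁ ++ u :: v :: l₂).length := by simp; omega
        rintro σ a b (⟨rfl, h⟩ | ⟨rfl, h⟩)
        · rcases (hc a b).mp h with h | h | h
          · have h' : (l₁ ++ u :: v :: l₂).Consec a b := (hc1 a b).mpr (Or.inl h)
            have hab := h'.lt hl1
            have hbu : t b ≤ t u := by
              have := h.mem_right
              simp only [List.mem_append, List.mem_singleton] at this
              rcases this with hb | rfl
              · rw [List.pairwise_append] at hl1
                exact (hl1.2.2 b hb u (by simp)).le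
              · exact le_rfl
            simp only [chord]
            nlinarith
          · exact hp.2 1 a b (Or.inl ⟨rfl, h⟩)
          · have h' : (l₁ ++ u :: v :: l₂).Consec a b := (hc1 a b).mpr (Or.inr (Or.inr h))
            have hab := h'.lt hl1
            have hva : t v ≤ t a := by
              have := h.mem_left
              simp only [List.mem_cons] at this
              rcases this with rfl | ha
              · exact le_rfl
              · simp only [List.pairwise_append, List.pairwise_cons] at hl1
                exact (hl1.2.1.2.1 a ha).le
            simp only [chord]
            nlinarith
        · have h' := (he a b).mp h
          have hau := (h'.le_and_le hl1 h2 hul).1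
          have hbv := (h'.le_and_le hl1 h2 hvl).2
          simp only [chord]
          nlinarith [mul_nonneg (sub_nonneg.mpr hau) (sub_nonneg.mpr hxv),
              mul_nonneg (sub_nonneg.mpr hbv) (sub_nonneg.mpr hxu),
              mul_nonneg (sub_nonneg.mpr hau) (sub_nonneg.mpr hbv)]
  rw [hreg, Set.image_union, him1, him2, hin]
  refine ⟨?_, rfl⟩
  -- A common image of the two regions lies on both sides of the chord, hence on it. It is then the
  -- image of a point of the segment `uv`, which belongs to both regions, and each drawing is
  -- injective.
  have cross : ∀ x ∈ K.region D₁, ∀ y ∈ K.region D₂, K.drawing t x = K.drawing t y → x = y := by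
    intro x hx y hy hxy
    have hpx : K.drawing t x ∈ inscribed t (l₁ ++ u :: v :: l₂) := him1 ▸ ⟨x, hx, rfl⟩
    have hpy : K.drawing t y ∈ inscribed t (u :: (m ++ [v])) := him2 ▸ ⟨y, hy, rfl⟩
    have hz1 := hpx.2 1 u v (Or.inl ⟨rfl, List.consec_append_pair _ _ _ _⟩)
    have hz2 := hpy.2 (-1) u v (Or.inr ⟨rfl, by simp⟩)
    rw [← hxy] at hz2
    have hz : chord (t u) (t v) (K.drawing t x) = 0 := by linarith
    obtain ⟨a, b, ha, hb, hab, habq⟩ := mem_segment_of_chord_eq_zero huv hpx.1 hz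
    have hmem : a • K.point (Sum.inl u) + b • K.point (Sum.inl v) ∈
        segment ℝ (K.point (Sum.inl u)) (K.point (Sum.inl v)) := ⟨a, b, ha, hb, hab, rfl⟩
    have hd : K.drawing t (a • K.point (Sum.inl u) + b • K.point (Sum.inl v)) =
        K.drawing t x := by
      simp only [map_add, map_smul, drawing_point, position, habq]
    exact (hi1 (hs₁ hmem) hx hd).symm.trans (hi2 (hs₂ hmem) hy (hd.trans hxy))
  rintro x (hx | hx) y (hy | hy) hxy
  · exact hi1 hx hy hxy
  · exact cross x hx y hy hxy
  · exact (cross y hy x hx hxy.symm).symm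
  · exact hi2 hx hy hxy

end Drawing

end PolygonalComplex

/-! ### From planar drawings to discs; patches and their gluing. -/

namespace PolygonalComplex

variable {V : Type*} {K : PolygonalComplex V}

lemma pairwise_idxOf {α : Type*} [DecidableEq α] {l : List α} (hl : l.Nodup) :
    l.Pairwise fun a b => (l.idxOf a : ℝ) < l.idxOf b := by
  rw [List.pairwise_iff_getElem]
  intro i j hi hj hij
  rw [hl.idxOf_getElem, hl.idxOf_getElem]
  exact_mod_cast hij

/-- With positions in `l` as parameters, the drawing is a continuous bijection from a compact space
onto a convex body, hence a homeomorphism. A convex body with interior points maps to the round disc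
with frontier going to the circle, and the frontier consists of the sides. -/
lemma IsPlanar.boundsDisc [Finite V] {D : Set K.facets} {l : List V} (h : K.IsPlanar D l)
    (hnd : l.Nodup) (h3 : 3 ≤ l.length) {C : K.graph.Subgraph}
    (hC : ∀ a b, C.Adj a b ↔ l.PolyAdj a b)
    (hsub : ∀ a b, C.Adj a b →
      segment ℝ (K.point (Sum.inl a)) (K.point (Sum.inl b)) ⊆ K.region D) :
    K.BoundsDisc C D := by
  classical
  set t : V → ℝ := fun v => l.idxOf v with ht
  have hl : l.Pairwise (t · < t ·) := pairwise_idxOf hnd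
  obtain ⟨hinj, him⟩ := h t hl
  have hcpt : IsCompact (inscribed t l) :=
    him ▸ (isCompact_region D).image (continuous_drawing t)
  have hint : (interior (inscribed t l)).Nonempty :=
    ⟨barycentre t l.toFinset, mem_interior_inscribed hl h3 fun σ u v hs =>
      hs.barycentre_pos hl h3 (by simp)⟩
  obtain ⟨e, -, he, hef⟩ := exists_homeomorph_image_interior_closure_frontier_eq_unitBall
    (convex_inscribed t l) hint hcpt.isBounded
  rw [(isClosed_inscribed t l).closure_eq] at he
  have hmem : ∀ x ∈ K.region D, K.drawing t x ∈ inscribed t l := fun x hx => him ▸ ⟨x, hx, rfl⟩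
  let ψ : K.region D → Metric.closedBall (0 : ℂ) 1 := fun x =>
    ⟨e (K.drawing t x), he ▸ ⟨_, hmem x x.2, rfl⟩⟩
  have hψc : Continuous ψ :=
    (e.continuous.comp ((continuous_drawing t).comp continuous_subtype_val)).subtype_mk _
  have hψb : Function.Bijective ψ := by
    constructor
    · intro x y hxy
      exact Subtype.ext (hinj x.2 y.2 (e.injective (congrArg Subtype.val hxy)))
    · rintro ⟨z, hz⟩
      rw [← he, ← him] at hz
      obtain ⟨_, ⟨x, hx, rfl⟩, rfl⟩ := hz
      exact ⟨⟨x, hx⟩, rfl⟩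
  have : CompactSpace (K.region D) := isCompact_iff_compactSpace.mp (isCompact_region D)
  refine ⟨Continuous.homeoOfEquivCompactToT2 (f := Equiv.ofBijective ψ hψb) hψc, fun x => ?_⟩
  change e (K.drawing t x) ∈ _ ↔ _
  rw [← hef, e.injective.mem_set_image, mem_frontier_inscribed hl h3 (hmem x x.2)]
  constructor
  · rintro ⟨σ, u, v, hs, h0⟩
    obtain ⟨a, b, ha, hb, hab, habx⟩ :=
      mem_segment_of_chord_eq_zero (hs.lt hl (by omega)) (hmem x x.2).1 h0
    have huv : C.Adj u v := (hC u v).mpr (List.polyAdj_iff_exists_isSide.mpr ⟨σ, Or.inl hs⟩)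
    have hy : a • K.point (Sum.inl u) + b • K.point (Sum.inl v) ∈
        segment ℝ (K.point (Sum.inl u)) (K.point (Sum.inl v)) := ⟨a, b, ha, hb, hab, rfl⟩
    refine ⟨u, v, huv, ?_⟩
    rwa [hinj x.2 (hsub u v huv hy) (by
      simp only [map_add, map_smul, drawing_point, position, habx])]
  · rintro ⟨u, v, huv, hx⟩
    have hseg : ∀ u v : V,
        x.1 ∈ segment ℝ (K.point (Sum.inl u)) (K.point (Sum.inl v)) →
        chord (t u) (t v) (K.drawing t x) = 0 := by
      rintro u v ⟨a, b, ha, hb, hab, hx⟩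
      refine chord_eq_zero_of_mem_segment ⟨a, b, ha, hb, hab, ?_⟩
      rw [← hx]
      simp only [map_add, map_smul, drawing_point, position]
    obtain ⟨σ, hs | hs⟩ := List.polyAdj_iff_exists_isSide.mp ((hC u v).mp huv)
    · exact ⟨σ, u, v, hs, hseg u v hx⟩
    · exact ⟨σ, v, u, hs, hseg v u (by rwa [segment_symm])⟩

/-- The facets in `D` form a disc whose boundary cycle has the cyclic vertex list `l`, and all
vertices of these facets lie on the boundary. -/
structure IsPatch [Finite V] (K : PolygonalComplex V) (D : Finset K.facets) (l : List V) :
    Prop where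
  planar : K.IsPlanar D l
  nodup : l.Nodup
  three_le : 3 ≤ l.length
  mem_iff : ∀ v, v ∈ l ↔ ∃ f ∈ D, v ∈ f.1.verts
  polyAdj : ∀ u v, ∀ f ∈ D, f.1.Adj u v → (∀ g ∈ D, g.1.Adj u v → g = f) → l.PolyAdj u v
  exists_adj : ∀ u v, l.PolyAdj u v → ∃ f ∈ D, f.1.Adj u v
  -- Each of the `D.card - 1` gluings identifies two vertices.
  count : l.length + 2 * D.card = ∑ f ∈ D, f.1.verts.ncard + 2

lemma isPatch_singleton [Finite V] {f : K.facets} {l : List V} (hf : f.1.IsListing l) :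
    K.IsPatch {f} l where
  planar := by simpa using isPlanar_singleton hf
  nodup := hf.nodup
  three_le := hf.three_le
  mem_iff v := by simp [hf.mem_iff]
  polyAdj u v g hg h _ := by
    rw [Finset.mem_singleton] at hg
    subst hg
    exact (hf.adj_iff u v).mp h
  exists_adj u v h := ⟨f, by simp, (hf.adj_iff u v).mpr h⟩
  count := by simp [hf.ncard_verts]

lemma IsPatch.segment_subset [Finite V] {D : Finset K.facets} {l : List V} (h : K.IsPatch D l)
    {u v : V} (huv : l.PolyAdj u v) :
    segment ℝ (K.point (Sum.inl u)) (K.point (Sum.inl v)) ⊆ K.region D := by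
  obtain ⟨f, hf, hadj⟩ := h.exists_adj u v huv
  exact (segment_subset_facetRegion hadj).trans (facetRegion_subset_region hf)

/-- Since the patches share only `u` and `v`, splicing their lists creates no repetition. The glued
edge lies in a facet of each patch, so it falls outside the scope of `polyAdj`. -/
lemma IsPatch.union [Finite V] [DecidableEq K.facets] {D₁ D₂ : Finset K.facets}
    {l₁ l₂ m : List V} {u v : V}
    (h₁ : K.IsPatch D₁ (l₁ ++ u :: v :: l₂)) (h₂ : K.IsPatch D₂ (u :: (m ++ [v])))
    (hD : Disjoint D₁ D₂)
    (hinter : ∀ w ∈ l₁ ++ u :: v :: l₂, w ∈ u :: (m ++ [v]) → w = u ∨ w = v) :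
    K.IsPatch (D₁ ∪ D₂) (l₁ ++ u :: (m ++ v :: l₂)) := by
  have huv₁ : (l₁ ++ u :: v :: l₂).PolyAdj u v := Or.inl (Or.inl (List.consec_append_pair ..))
  have huv₂ : (u :: (m ++ [v])).PolyAdj u v := Or.inl (Or.inr (by simp))
  refine ⟨?_, ?_, ?_, ?_, ?_, ?_, ?_⟩
  · rw [Finset.coe_union]
    exact h₁.planar.union h₂.planar (h₁.segment_subset huv₁) (h₂.segment_subset huv₂)
  · have hperm : (l₁ ++ u :: (m ++ v :: l₂)).Perm (m ++ (l₁ ++ u :: v :: l₂)) := by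
      refine (List.Perm.append_left l₁ ((List.perm_append_comm_assoc (u :: m) [] _).trans ?_)).trans
        (List.perm_append_comm_assoc l₁ m _)
      exact List.perm_append_comm_assoc [u] m (v :: l₂)
    have hnd := h₂.nodup
    simp only [List.nodup_cons, List.nodup_append, List.mem_append, List.mem_singleton,
      not_or] at hnd
    rw [hperm.nodup_iff, List.nodup_append]
    refine ⟨hnd.2.1, h₁.nodup, ?_⟩
    rintro a ha b hb rfl
    rcases hinter a hb (by simp [ha]) with rfl | rfl
    · exact hnd.1.1 ha
    · exact hnd.2.2.2 a ha a rfl rfl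
  · have := h₁.three_le
    simp at this ⊢
    omega
  · intro w
    have e1 := h₁.mem_iff w
    have e2 := h₂.mem_iff w
    simp only [List.mem_append, List.mem_cons, List.not_mem_nil, or_false] at e1 e2
    simp only [List.mem_append, List.mem_cons, Finset.mem_union, or_and_right, exists_or, ← e1,
      ← e2]
    tauto
  · intro a b f hf hadj huniq
    rw [Finset.mem_union] at hf
    rcases hf with hf | hf
    · refine (h₁.polyAdj a b f hf hadj fun g hg => huniq g (Finset.mem_union_left _ hg)).splice_left
        fun hab => ?_
      obtain ⟨g, hg, hguv⟩ := h₂.exists_adj u v huv₂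
      have : g.1.Adj a b := by rwa [← Subgraph.mem_edgeSet, hab, Subgraph.mem_edgeSet]
      obtain rfl := huniq g (Finset.mem_union_right _ hg) this
      exact Finset.disjoint_left.mp hD hf hg
    · refine (h₂.polyAdj a b f hf hadj
        fun g hg => huniq g (Finset.mem_union_right _ hg)).splice_right fun hab => ?_
      obtain ⟨g, hg, hguv⟩ := h₁.exists_adj u v huv₁
      have : g.1.Adj a b := by rwa [← Subgraph.mem_edgeSet, hab, Subgraph.mem_edgeSet]
      obtain rfl := huniq g (Finset.mem_union_left _ hg) this
      exact Finset.disjoint_left.mp hD hg hf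
  · intro a b h
    rcases h.of_splice with h | h
    · obtain ⟨f, hf, h⟩ := h₁.exists_adj a b h
      exact ⟨f, Finset.mem_union_left _ hf, h⟩
    · obtain ⟨f, hf, h⟩ := h₂.exists_adj a b h
      exact ⟨f, Finset.mem_union_right _ hf, h⟩
  · rw [Finset.card_union_of_disjoint hD, Finset.sum_union hD]
    have e1 := h₁.count
    have e2 := h₂.count
    simp at e1 e2 ⊢
    omega

end PolygonalComplex

/-! ### Acyclicity in the ambient vertex set, and cycles from lists. -/

namespace SimpleGraph

variable {V : Type*} {G : SimpleGraph V}

/-- A cycle of `T.spanningCoe` uses only edges of `T` and so lifts to `T.coe`. Working in the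
spanning graph allows walks between facets to be compared without subtypes. -/
lemma Subgraph.isAcyclic_spanningCoe {T : G.Subgraph} (hT : T.coe.IsAcyclic) :
    T.spanningCoe.IsAcyclic := by
  intro a c hc
  have hle : (c.mapLe T.spanningCoe_le).toSubgraph ≤ T := by
    have hne : ¬ (c.mapLe T.spanningCoe_le).Nil := by
      simpa using ((Walk.isCycle_mapLe T.spanningCoe_le).mpr hc).not_nil
    rw [Walk.toSubgraph_le_iff hne]
    intro e he
    simp only [Walk.edgeSet, Walk.edges_mapLe_eq_edges] at he
    have := c.edges_subset_edgeSet he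
    rwa [Subgraph.edgeSet_spanningCoe] at this
  have hcyc : (c.mapLe T.spanningCoe_le).mapToSubgraph.IsCycle := by
    refine Walk.IsCycle.of_map (f := Subgraph.hom _) ?_
    rw [Walk.map_mapToSubgraph_hom]
    exact (Walk.isCycle_mapLe T.spanningCoe_le).mpr hc
  exact hT _ (hcyc.map (Subgraph.inclusion.injective hle))

lemma _root_.List.isChain_of_consec {R : V → V → Prop} {l : List V}
    (h : ∀ a b, l.Consec a b → R a b) : l.IsChain R := by
  induction l with
  | nil => simp
  | cons x l ih =>
    cases l with
    | nil => simp
    | cons y l =>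
      rw [List.isChain_cons_cons]
      exact ⟨h x y (by simp), ih fun a b hab => h a b (Or.inr hab)⟩

lemma exists_cycle_of_list {l : List V} (hnd : l.Nodup) (h3 : 3 ≤ l.length)
    (hG : ∀ a b, l.PolyAdj a b → G.Adj a b) :
    ∃ (a : V) (w : G.Walk a a), w.IsCycle ∧ w.length = l.length ∧
      ∀ a b, w.toSubgraph.Adj a b ↔ l.PolyAdj a b := by
  have hne : l ≠ [] := by rintro rfl; simp at h3
  have hchain : l.IsChain G.Adj :=
    List.isChain_of_consec fun a b h => hG a b (Or.inl (Or.inl h))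
  set p := Walk.ofSupport l hne hchain with hp
  have hsupp : p.support = l := Walk.support_ofSupport hne hchain
  have hlen : p.length + 1 = l.length := by rw [← Walk.length_support, hsupp]
  have hpath : p.IsPath := by rw [Walk.isPath_def, hsupp]; exact hnd
  have hends : l.Ends (l.head hne) (l.getLast hne) :=
    ⟨List.head?_eq_some_head hne, List.getLast?_eq_some_getLast hne⟩
  have hends' : ∀ a b, l.Ends a b ↔ a = l.head hne ∧ b = l.getLast hne := fun a b => by
    rw [List.Ends, hends.1, hends.2]; simp [eq_comm]
  have hadj : G.Adj (l.getLast hne) (l.head hne) := (hG _ _ (Or.inl (Or.inr hends))).symm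
  refine ⟨_, Walk.cons hadj p, ?_, ?_, ?_⟩
  · rw [Walk.cons_isCycle_iff]
    refine ⟨hpath, fun h => ?_⟩
    rw [Sym2.eq_swap] at h
    have := hpath.length_eq_one_of_mem_edges h
    omega
  · simpa using hlen
  · intro a b
    rw [Walk.adj_toSubgraph_iff_mem_edges, Walk.edges_cons, List.mem_cons, Sym2.eq_iff,
      Walk.consec_support_iff, hsupp, List.PolyAdj, hends', hends']
    tauto

end SimpleGraph

/-! ### A proper tree yields a contractible Hamiltonian cycle. -/

namespace PolygonalComplex

variable {V : Type*} {K : PolygonalComplex V}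

/-- A facet of a proper tree that is adjacent to a subtree meets the facets of the subtree only in
the common edge. -/
lemma IsProperTree.mem_of_mem {T : K.dualGraph.Subgraph} (hT : K.IsProperTree T)
    {D : Finset K.facets} {f g j : K.facets} (hf : f ∉ D) (hfg : T.Adj f g)
    (R : T.spanningCoe.Walk g j) (hR : R.IsPath) (hRD : ∀ x ∈ R.support, x ∈ D)
    {w : V} (hwf : w ∈ f.1.verts) (hwj : w ∈ j.1.verts) : w ∈ g.1.verts := by
  have hj : j ∈ T.verts := by
    cases R.reverse with
    | nil => exact hfg.snd_mem
    | cons h _ => exact T.edge_vert h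
  obtain ⟨p, hp, hpw, hpT⟩ := hT.path_mem w f j hfg.fst_mem hj hwf hwj
  have htr : ∀ e ∈ p.edges, e ∈ T.spanningCoe.edgeSet := by
    intro e he
    rw [Subgraph.edgeSet_spanningCoe]
    exact Subgraph.edgeSet_mono hpT (by simpa using he)
  have hq : (Walk.cons (show T.spanningCoe.Adj f g from hfg) R).IsPath :=
    hR.cons fun h => hf (hRD f h)
  -- Paths in a forest are unique, so the path `p` around `w` is the one that starts with the edge
  -- `fg`. Hence this edge lies on the face of `w`.
  have heq := congrArg Subtype.val (((Subgraph.isAcyclic_spanningCoe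
    hT.isTree.isAcyclic).subsingleton_path f j).elim ⟨p.transfer _ htr, hp.transfer htr⟩ ⟨_, hq⟩)
  have hmem : s(f, g) ∈ p.edges := by
    rw [← Walk.edges_transfer p htr]
    simp only at heq
    rw [heq]
    simp
  have : (K.dualFace w).Adj f g :=
    hpw.2 (Walk.adj_toSubgraph_iff_mem_edges.mpr hmem)
  exact this.snd_mem

/-- The patch grows by one facet along a tree edge leaving `D`. Connectedness of `D` inside the tree
is carried through the induction because `mem_of_mem` needs a tree path within `D`. -/
lemma IsProperTree.exists_patch [Finite V] (hK : K.IsPolyhedralMap) {T : K.dualGraph.Subgraph}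
    (hT : K.IsProperTree T) (k : ℕ) (hk : k + 1 ≤ T.verts.ncard) :
    ∃ (D : Finset K.facets) (l : List V), D.card = k + 1 ∧ (∀ f ∈ D, f ∈ T.verts) ∧
      (∀ f ∈ D, ∀ g ∈ D, ∃ R : T.spanningCoe.Walk f g, R.IsPath ∧ ∀ x ∈ R.support, x ∈ D) ∧
      K.IsPatch D l := by
  classical
  induction k with
  | zero =>
    obtain ⟨f, hf⟩ := Set.nonempty_of_ncard_ne_zero (s := T.verts) (by omega)
    obtain ⟨u, v, huv⟩ := (isCycleGraph f).nonempty
    obtain ⟨m, hm⟩ := (isCycleGraph f).exists_isListing huv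
    refine ⟨{f}, _, by simp, by simpa using hf, ?_, isPatch_singleton hm⟩
    intro a ha b hb
    rw [Finset.mem_singleton] at ha hb
    subst ha hb
    exact ⟨Walk.nil, by simp, by simp⟩
  | succ k ih =>
    obtain ⟨D, l, hcard, hDT, hconn, hpatch⟩ := ih (by omega)
    obtain ⟨g₀, hg₀⟩ : D.Nonempty := Finset.card_pos.mp (by omega)
    obtain ⟨f₀, hf₀T, hf₀⟩ : ∃ f ∈ T.verts, f ∉ D := by
      by_contra! hcon
      have := Set.ncard_le_ncard (s := T.verts) (t := D) hcon
      rw [Set.ncard_coe_finset] at this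
      omega
    obtain ⟨p⟩ := hT.isTree.connected.preconnected ⟨g₀, hDT g₀ hg₀⟩ ⟨f₀, hf₀T⟩
    obtain ⟨d, -, hd1, hd2⟩ := p.exists_boundary_dart {x | x.1 ∈ D} hg₀ hf₀
    set g : K.facets := d.fst.1
    set f : K.facets := d.snd.1
    have hgD : g ∈ D := hd1
    have hfD : f ∉ D := hd2
    have hgf : T.Adj g f := d.adj
    obtain ⟨hne, u₀, v₀, hgu, hfu⟩ := hgf.adj_sub
    -- The only other facet at this edge is `f`, which is not in `D`, so the edge is on the boundary
    -- of the patch.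
    have hpoly : l.PolyAdj u₀ v₀ := hpatch.polyAdj u₀ v₀ g hgD hgu fun j hj hju => by
      rcases hK.eq_or_eq hne hgu hfu hju with h | h
      · exact h
      · exact absurd (h ▸ hj) hfD
    obtain ⟨u, v, hgu, hfu, hpoly⟩ : ∃ u v, g.1.Adj u v ∧ f.1.Adj u v ∧
        (l.Consec u v ∨ l.Ends u v) := by
      rcases hpoly with h | h
      · exact ⟨u₀, v₀, hgu, hfu, h⟩
      · exact ⟨v₀, u₀, hgu.symm, hfu.symm, h⟩
    have hinter : ∀ w ∈ l, w ∈ f.1.verts → w = u ∨ w = v := by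
      intro w hw hwf
      obtain ⟨j, hj, hwj⟩ := (hpatch.mem_iff w).mp hw
      obtain ⟨R, hR, hRD⟩ := hconn g hgD j hj
      exact hK.mem_inter hne hgu hfu (hT.mem_of_mem hfD hgf.symm R hR hRD hwf hwj) hwf
    obtain ⟨m, hm⟩ := (isCycleGraph f).exists_isListing hfu
    have hdisj : Disjoint D {f} := by simpa using hfD
    refine ⟨D ∪ {f}, ?_⟩
    obtain ⟨l', hl'⟩ : ∃ l', K.IsPatch (D ∪ {f}) l' := by
      -- If `u` and `v` are consecutive in `l`, the new facet is spliced into `l`. If they are the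
      -- ends of `l`, the roles are exchanged and `l` is spliced into a listing of the new facet.
      rcases hpoly with h | h
      · obtain ⟨l₁, l₂, rfl⟩ := h.exists_append
        exact ⟨_, hpatch.union (isPatch_singleton hm) hdisj fun w hw hw' =>
          hinter w hw ((hm.mem_iff w).mp hw')⟩
      · obtain ⟨m', rfl⟩ := h.exists_eq (by have := hpatch.three_le; omega)
        rw [Finset.union_comm]
        exact ⟨_, (isPatch_singleton hm.reverse_append).union hpatch hdisj.symm fun w hw hw' =>
          hinter w hw' ((hm.reverse_append.mem_iff w).mp hw)⟩
    refine ⟨l', ?_, ?_, ?_, hl'⟩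
    · rw [Finset.card_union_of_disjoint hdisj, hcard, Finset.card_singleton]
    · intro j hj
      rw [Finset.mem_union, Finset.mem_singleton] at hj
      rcases hj with hj | rfl
      · exact hDT j hj
      · exact hgf.snd_mem
    · have hfj : ∀ j ∈ D, ∃ R : T.spanningCoe.Walk f j, R.IsPath ∧
          ∀ x ∈ R.support, x ∈ D ∪ {f} := by
        intro j hj
        obtain ⟨R, hR, hRD⟩ := hconn g hgD j hj
        refine ⟨Walk.cons (show T.spanningCoe.Adj f g from hgf.symm) R,
          hR.cons fun h => hfD (hRD f h), ?_⟩
        intro x hx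
        rw [Walk.support_cons, List.mem_cons] at hx
        rw [Finset.mem_union, Finset.mem_singleton]
        rcases hx with hx | hx
        · exact Or.inr hx
        · exact Or.inl (hRD x hx)
      intro a ha b hb
      rw [Finset.mem_union, Finset.mem_singleton] at ha hb
      rcases ha with ha | rfl <;> rcases hb with hb | rfl
      · obtain ⟨R, hR, hRD⟩ := hconn a ha b hb
        exact ⟨R, hR, fun x hx => Finset.mem_union_left _ (hRD x hx)⟩
      · obtain ⟨R, hR, hRD⟩ := hfj a ha
        exact ⟨R.reverse, hR.reverse, by simpa using hRD⟩
      · exact hfj b hb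
      · exact ⟨Walk.nil, by simp, by simp⟩

theorem IsProperTree.hasContractibleHamiltonianCycle [Finite V] [DecidableEq V]
    (hK : K.IsPolyhedralMap) {T : K.dualGraph.Subgraph} (hT : K.IsProperTree T) :
    K.HasContractibleHamiltonianCycle := by
  classical
  have hpos : 0 < T.verts.ncard := by
    rw [Set.ncard_pos]
    obtain ⟨x⟩ := hT.isTree.connected.nonempty
    exact ⟨x.1, x.2⟩
  obtain ⟨D, l, hcard, hDT, -, hpatch⟩ := hT.exists_patch hK (T.verts.ncard - 1) (by omega)
  have hD : (D : Set K.facets) = T.verts :=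
    Set.eq_of_subset_of_ncard_le hDT (by rw [Set.ncard_coe_finset]; omega)
  have hsum := hT.degree_sum
  rw [← hD, finsum_mem_coe_finset, Set.ncard_coe_finset] at hsum
  simp only [hK.ncard_neighborSet] at hsum
  have hcount := hpatch.count
  -- The patch count compared with the degree sum; `hpos` makes the truncated subtraction harmless.
  have hlen : l.length = Nat.card V := by omega
  have hG : ∀ a b, l.PolyAdj a b → K.graph.Adj a b := fun a b h => by
    obtain ⟨f, -, h⟩ := hpatch.exists_adj a b h
    exact h.adj_sub
  obtain ⟨a, w, hw, hwl, hwadj⟩ := exists_cycle_of_list hpatch.nodup hpatch.three_le hG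
  refine ⟨a, w, ?_, D, ?_⟩
  · let := Fintype.ofFinite V
    rw [Walk.isHamiltonianCycle_iff_isCycle_and_length_eq]
    exact ⟨hw, by rw [hwl, hlen, Nat.card_eq_fintype_card]⟩
  · exact hpatch.planar.boundsDisc hpatch.nodup hpatch.three_le hwadj fun a b h =>
      hpatch.segment_subset ((hwadj a b).mp h)

end PolygonalComplex

/-! ### Topological lemmas -/

/-- A continuous function without zeros on a star-shaped set has a continuous logarithm. -/
lemma StarConvex.exists_continuous_log {E : Type*} [AddCommGroup E] [Module ℝ E]
    [TopologicalSpace E] [ContinuousAdd E] [ContinuousSMul ℝ E] {S : Set E} {x₀ : E}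
    (hS : StarConvex ℝ x₀ S) (hx₀ : x₀ ∈ S) {ψ : S → ℂ} (hψ : Continuous ψ)
    (h0 : ∀ x, ψ x ≠ 0) : ∃ L : S → ℂ, Continuous L ∧ ∀ x, Complex.exp (L x) = ψ x := by
  have hmem : ∀ (s : unitInterval) (x : S), (1 - s : ℝ) • x₀ + (s : ℝ) • (x : E) ∈ S :=
    fun s x => hS x.2 (sub_nonneg.mpr s.2.2) s.2.1 (by ring)
  -- The contraction to `x₀`, composed with `ψ`, is lifted through the covering `exp`, starting from
  -- a constant logarithm; its end gives the logarithm of `ψ`.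
  let H : C(unitInterval × S, {z : ℂ // z ≠ 0}) :=
    ⟨fun y => ⟨ψ ⟨(1 - y.1 : ℝ) • x₀ + (y.1 : ℝ) • (y.2 : E), hmem y.1 y.2⟩, h0 _⟩, by fun_prop⟩
  let c : C(S, ℂ) := ⟨fun _ => Complex.log (ψ ⟨x₀, hx₀⟩), continuous_const⟩
  have hc : ∀ x, H (0, x) = (⟨Complex.exp (c x), Complex.exp_ne_zero _⟩ : {z : ℂ // z ≠ 0}) := by
    intro x
    ext
    simp [H, c, Complex.exp_log (h0 _)]
  let L := Complex.isCoveringMap_exp.liftHomotopy H c hc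
  refine ⟨fun x => L (1, x), by fun_prop, fun x => ?_⟩
  have : Complex.exp (L (1, x)) = H (1, x) := congrArg Subtype.val
    (congrFun (Complex.isCoveringMap_exp.liftHomotopy_lifts H c hc) (1, x))
  rw [this]
  simp [H]

/-- The circle does not embed into the line. -/
lemma not_injective_of_sphere {φ : Metric.sphere (0 : ℂ) 1 → ℝ} (hφ : Continuous φ) :
    ¬ Function.Injective φ := by
  intro hinj
  let γ : ℝ → Metric.sphere (0 : ℂ) 1 := fun θ => ⟨Complex.exp (θ * Complex.I), by
    simp [Complex.norm_exp_ofReal_mul_I]⟩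
  have hγ : Continuous γ := by fun_prop
  have hγπ : ∀ θ, γ (θ + Real.pi) = -γ θ := fun θ => by
    ext
    simp [γ, add_mul, Complex.exp_add]
  -- Half a turn changes the sign of `d`, so `d` has a zero: two antipodal points with the same
  -- value of `φ`.
  let d : ℝ → ℝ := fun θ => φ (γ θ) - φ (-γ θ)
  have hd : Continuous d := by fun_prop
  have hdπ : d Real.pi = - d 0 := by
    have := hγπ 0
    rw [zero_add] at this
    simp [d, this]
  obtain ⟨θ, -, hθ⟩ : (0 : ℝ) ∈ d '' Set.uIcc 0 Real.pi := by
    refine intermediate_value_uIcc hd.continuousOn ?_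
    rw [hdπ, Set.mem_uIcc]
    rcases le_total 0 (d 0) with h | h
    · right; constructor <;> linarith
    · left; constructor <;> linarith
  have := congrArg Subtype.val (hinj (sub_eq_zero.mp hθ))
  simp only [Metric.sphere, γ] at this
  have h2 : (Complex.exp (θ * Complex.I)) = -Complex.exp (θ * Complex.I) := this
  exact Complex.exp_ne_zero _ (self_eq_neg.mp h2)

/-- There is no continuous logarithm on a circle. -/
lemma not_exists_log_circle {L : Metric.sphere (0 : ℂ) 1 → ℂ} (hL : Continuous L) {r : ℝ}
    (hr : 0 < r) (h : ∀ z, Complex.exp (L z) = r * z) : False := by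
  -- The modulus `r` fixes the real part of `L`, so its imaginary part would be injective on the
  -- circle.
  refine not_injective_of_sphere (φ := fun z => (L z).im) (by fun_prop) fun z w hzw => ?_
  have hn : ∀ z, Real.exp (L z).re = r := fun z => by
    have h1 := congrArg norm (h z)
    have h2 : ‖(z : ℂ)‖ = 1 := by simp
    rwa [Complex.norm_exp, norm_mul, h2, Complex.norm_real, Real.norm_of_nonneg hr.le, mul_one]
      at h1
  have hre : (L z).re = (L w).re := Real.exp_injective ((hn z).trans (hn w).symm)
  have hLL : L z = L w := Complex.ext hre hzw
  have : (r : ℂ) * z = r * w := by rw [← h, ← h, hLL]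
  exact Subtype.ext (mul_left_cancel₀ (by exact_mod_cast hr.ne') this)

/-- If `exp ∘ L` avoids a ray, then `L` and the corresponding branch of the logarithm differ by a
constant on preconnected sets. -/
lemma im_sub_arg_eq {X : Type*} [TopologicalSpace X] {S : Set X} (hS : IsPreconnected S)
    {L : X → ℂ} (hL : ContinuousOn L S) {c : ℂ} (hc : c ≠ 0)
    (h : ∀ x ∈ S, c * Complex.exp (L x) ∈ Complex.slitPlane) {x y : X} (hx : x ∈ S) (hy : y ∈ S) :
    (L x).im - (c * Complex.exp (L x)).arg = (L y).im - (c * Complex.exp (L y)).arg := by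
  let N : X → ℝ := fun x => (L x).im - (c * Complex.exp (L x)).arg
  have hN : ContinuousOn N S := by
    intro x hx
    refine ContinuousWithinAt.sub ?_ ?_
    · exact Complex.continuous_im.continuousAt.comp_continuousWithinAt (hL x hx)
    · exact (Complex.continuousAt_arg (h x hx)).comp_continuousWithinAt
        (f := fun x => c * Complex.exp (L x))
        (continuousWithinAt_const.mul (hL x hx).cexp)
  -- The difference takes values in a translate of `2π ℤ`, so it cannot vary on a preconnected set.
  have hdisc : ∀ x, ∃ n : ℤ, N x = -c.arg + n * (2 * Real.pi) := by
    intro x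
    have h1 : ((c * Complex.exp (L x)).arg : Real.Angle) = c.arg + ((L x).im : Real.Angle) := by
      rw [Complex.arg_mul_coe_angle hc (Complex.exp_ne_zero _),
        Complex.exp_eq_exp_re_mul_sin_add_cos, ← Complex.ofReal_exp,
        ← Complex.ofReal_cos, ← Complex.ofReal_sin, ← Real.Angle.cos_coe, ← Real.Angle.sin_coe,
        Complex.arg_mul_cos_add_sin_mul_I_coe_angle (Real.exp_pos _)]
    have h2 : ((N x : ℝ) : Real.Angle) = ((-c.arg : ℝ) : Real.Angle) := by
      simp only [N, Real.Angle.coe_sub, Real.Angle.coe_neg, h1]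
      abel
    obtain ⟨n, hn⟩ := Real.Angle.angle_eq_iff_two_pi_dvd_sub.mp h2
    exact ⟨n, by linarith⟩
  have himg : IsPreconnected (N '' S) := hS.image N hN
  by_contra hne
  have key : ∀ x ∈ S, ∀ y ∈ S, ¬ N x < N y := by
    intro x hx y hy hlt
    obtain ⟨n, hn⟩ := hdisc x
    obtain ⟨m, hm⟩ := hdisc y
    have hnm : n < m := by
      by_contra! hle
      have : (m : ℝ) ≤ n := by exact_mod_cast hle
      nlinarith [Real.pi_pos]
    have hnm' : (n : ℝ) + 1 ≤ m := by exact_mod_cast hnm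
    have hmid : N x + Real.pi ∈ N '' S := himg.ordConnected.out ⟨x, hx, rfl⟩ ⟨y, hy, rfl⟩
      ⟨by linarith [Real.pi_pos], by nlinarith [Real.pi_pos]⟩
    obtain ⟨z, -, hz⟩ := hmid
    obtain ⟨k, hk⟩ := hdisc z
    have h1 : (2 * (k - n) : ℝ) * Real.pi = 1 * Real.pi := by linarith
    have h2 := mul_right_cancel₀ Real.pi_ne_zero h1
    have h3 : 2 * (k - n) = 1 := by exact_mod_cast h2
    omega
  rcases lt_trichotomy (N x) (N y) with h | h | h
  · exact key x hx y hy h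
  · exact hne h
  · exact key y hy x hx h

/-! ### Local topology of a disc made of facets. -/

namespace PolygonalComplex

variable {V : Type*} {K : PolygonalComplex V}

/-! ### Coordinates -/

lemma point_apply_self (i : V ⊕ K.facets) : K.point i i = 1 := by
  classical simp [point]

lemma point_apply_of_ne {i j : V ⊕ K.facets} (h : j ≠ i) : K.point i j = 0 := by
  classical simp [point, h]

lemma point_apply_nonneg (i j : V ⊕ K.facets) : 0 ≤ K.point i j := by
  by_cases h : j = i
  · rw [h, point_apply_self]; exact zero_le_one
  · rw [point_apply_of_ne h]

@[simp] lemma point_inl_inr (u : V) (f : K.facets) : K.point (Sum.inl u) (Sum.inr f) = 0 :=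
  point_apply_of_ne (by simp)

@[simp] lemma point_inr_inl (u : V) (f : K.facets) : K.point (Sum.inr f) (Sum.inl u) = 0 :=
  point_apply_of_ne (by simp)

lemma coord_nonneg {f : K.facets} {x : V ⊕ K.facets → ℝ} (hx : x ∈ K.facetRegion f)
    (i : V ⊕ K.facets) : 0 ≤ x i := by
  obtain ⟨u, v, a, b, c, -, ha, hb, hc, -, rfl⟩ := mem_facetRegion_iff.mp hx
  have h1 := point_apply_nonneg (K := K) (Sum.inl u) i
  have h2 := point_apply_nonneg (K := K) (Sum.inl v) i
  have h3 := point_apply_nonneg (K := K) (Sum.inr f) i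
  simp only [Pi.add_apply, Pi.smul_apply, smul_eq_mul]
  positivity

lemma coord_inr_eq_zero {f g : K.facets} {x : V ⊕ K.facets → ℝ} (hx : x ∈ K.facetRegion f)
    (hg : g ≠ f) : x (Sum.inr g) = 0 := by
  obtain ⟨u, v, a, b, c, -, -, -, -, -, rfl⟩ := mem_facetRegion_iff.mp hx
  simp [point_apply_of_ne (i := Sum.inr f) (j := Sum.inr g) (by simpa using hg)]

lemma combo_apply_left {u v : V} (h : u ≠ v) (f : K.facets) (a b c : ℝ) :
    (a • K.point (Sum.inl u) + b • K.point (Sum.inl v) + c • K.point (Sum.inr f)) (Sum.inl u)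
      = a := by
  simp [point_apply_self, point_apply_of_ne (i := Sum.inl v) (j := Sum.inl u) (by simpa using h)]

lemma combo_apply_right {u v : V} (h : u ≠ v) (f : K.facets) (a b c : ℝ) :
    (a • K.point (Sum.inl u) + b • K.point (Sum.inl v) + c • K.point (Sum.inr f)) (Sum.inl v)
      = b := by
  simp [point_apply_self,
    point_apply_of_ne (i := Sum.inl u) (j := Sum.inl v) (by simpa using h.symm)]

lemma combo_apply_centre (u v : V) (f : K.facets) (a b c : ℝ) :
    (a • K.point (Sum.inl u) + b • K.point (Sum.inl v) + c • K.point (Sum.inr f)) (Sum.inr f)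
      = c := by
  simp [point_apply_self]

lemma combo_apply_of_ne {u v w : V} (hu : w ≠ u) (hv : w ≠ v) (f : K.facets) (a b c : ℝ) :
    (a • K.point (Sum.inl u) + b • K.point (Sum.inl v) + c • K.point (Sum.inr f)) (Sum.inl w)
      = 0 := by
  simp [point_apply_of_ne (i := Sum.inl u) (j := Sum.inl w) (by simpa using hu),
    point_apply_of_ne (i := Sum.inl v) (j := Sum.inl w) (by simpa using hv)]

/-- A point of a facet with two positive vertex coordinates lies in the corresponding triangle. -/
lemma mem_triangle {f : K.facets} {x : V ⊕ K.facets → ℝ} (hx : x ∈ K.facetRegion f) {u v : V}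
    (huv : u ≠ v) (hu : 0 < x (Sum.inl u)) (hv : 0 < x (Sum.inl v)) :
    f.1.Adj u v ∧ x (Sum.inl u) + x (Sum.inl v) + x (Sum.inr f) = 1 ∧
      x = x (Sum.inl u) • K.point (Sum.inl u) + x (Sum.inl v) • K.point (Sum.inl v) +
        x (Sum.inr f) • K.point (Sum.inr f) := by
  obtain ⟨a, b, α, β, c, hab, -, -, -, hsum, rfl⟩ := mem_facetRegion_iff.mp hx
  have hua : u = a ∨ u = b := by
    by_contra! h
    rw [combo_apply_of_ne h.1 h.2] at hu
    exact lt_irrefl _ hu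
  have hva : v = a ∨ v = b := by
    by_contra! h
    rw [combo_apply_of_ne h.1 h.2] at hv
    exact lt_irrefl _ hv
  rcases hua with rfl | rfl <;> rcases hva with rfl | rfl
  · exact absurd rfl huv
  · rw [combo_apply_left hab.ne, combo_apply_right hab.ne, combo_apply_centre]
    exact ⟨hab, hsum, rfl⟩
  · rw [combo_apply_left hab.ne, combo_apply_right hab.ne, combo_apply_centre]
    exact ⟨hab.symm, by linarith, by rw [add_comm (β • _)]⟩
  · exact absurd rfl huv

lemma eq_point_of_coord_eq_one {f : K.facets} {x : V ⊕ K.facets → ℝ} (hx : x ∈ K.facetRegion f)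
    {u : V} (hu : x (Sum.inl u) = 1) : x = K.point (Sum.inl u) := by
  obtain ⟨a, b, α, β, c, hab, hα, hβ, hc, hsum, rfl⟩ := mem_facetRegion_iff.mp hx
  have hua : u = a ∨ u = b := by
    by_contra! h
    rw [combo_apply_of_ne h.1 h.2] at hu
    exact zero_ne_one hu
  rcases hua with rfl | rfl
  · rw [combo_apply_left hab.ne] at hu
    have h1 : β = 0 := by linarith
    have h2 : c = 0 := by linarith
    simp [hu, h1, h2]
  · rw [combo_apply_right hab.ne] at hu
    have h1 : α = 0 := by linarith
    have h2 : c = 0 := by linarith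
    simp [hu, h1, h2]

lemma coord_inr_of_mem_edgeRegion {C : K.graph.Subgraph} {x : V ⊕ K.facets → ℝ}
    (hx : x ∈ K.edgeRegion C) (f : K.facets) : x (Sum.inr f) = 0 := by
  obtain ⟨u, v, -, a, b, -, -, -, rfl⟩ := hx
  simp

lemma adj_of_mem_edgeRegion {C : K.graph.Subgraph} {x : V ⊕ K.facets → ℝ}
    (hx : x ∈ K.edgeRegion C) {u v : V} (huv : u ≠ v) (hu : 0 < x (Sum.inl u))
    (hv : 0 < x (Sum.inl v)) : C.Adj u v := by
  obtain ⟨a, b, hab, α, β, -, -, -, rfl⟩ := hx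
  have hne : ∀ w, 0 < (α • K.point (Sum.inl a) + β • K.point (Sum.inl b)) (Sum.inl w) →
      w = a ∨ w = b := by
    intro w hw
    by_contra! h
    simp [point_apply_of_ne (i := Sum.inl a) (j := Sum.inl w) (by simpa using h.1),
      point_apply_of_ne (i := Sum.inl b) (j := Sum.inl w) (by simpa using h.2)] at hw
  rcases hne u hu with rfl | rfl <;> rcases hne v hv with rfl | rfl
  · exact absurd rfl huv
  · exact hab
  · exact hab.symm
  · exact absurd rfl huv

lemma continuous_coord {S : Set (V ⊕ K.facets → ℝ)} (i : V ⊕ K.facets) :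
    Continuous fun y : S => y.1 i :=
  (continuous_apply i).comp continuous_subtype_val

/-- A point on the segment from the midpoint of an edge to the centre of a facet. -/
noncomputable def spoke (f : K.facets) (u v : V) (s : ℝ) : V ⊕ K.facets → ℝ :=
  (s / 2) • K.point (Sum.inl u) + (s / 2) • K.point (Sum.inl v) + (1 - s) • K.point (Sum.inr f)

lemma continuous_spoke (f : K.facets) (u v : V) : Continuous (spoke f u v) := by
  unfold spoke
  fun_prop

lemma spoke_zero (f : K.facets) (u v : V) : spoke f u v 0 = K.point (Sum.inr f) := by
  simp [spoke]

lemma spoke_one (f g : K.facets) (u v : V) : spoke f u v 1 = spoke g u v 1 := by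
  simp [spoke]

lemma spoke_mem {f : K.facets} {u v : V} (h : f.1.Adj u v) {s : ℝ} (h0 : 0 ≤ s) (h1 : s ≤ 1) :
    spoke f u v s ∈ K.facetRegion f :=
  mem_facetRegion_iff.mpr ⟨u, v, s / 2, s / 2, 1 - s, h, by linarith, by linarith, by linarith,
    by ring, rfl⟩

lemma spoke_notMem_edgeRegion {f : K.facets} {u v : V} (huv : u ≠ v) {C : K.graph.Subgraph}
    {s : ℝ} (h : s ≠ 1 ∨ ¬ C.Adj u v) : spoke f u v s ∉ K.edgeRegion C := by
  intro hmem
  have h1 := coord_inr_of_mem_edgeRegion hmem f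
  rw [spoke, combo_apply_centre] at h1
  obtain rfl : s = 1 := by linarith
  refine h.resolve_left (by simp) (adj_of_mem_edgeRegion hmem huv ?_ ?_)
  · rw [spoke, combo_apply_left huv]; norm_num
  · rw [spoke, combo_apply_right huv]; norm_num

/-! ### Discs bounded by a cycle -/

/-- Both maps restrict the given homeomorphism. The single identity is enough to carry connectedness
and logarithms from the open ball to the interior. -/
lemma BoundsDisc.interior_retract {C : K.graph.Subgraph} {D : Set K.facets}
    (h : K.BoundsDisc C D) :
    ∃ (σ : Metric.ball (0 : ℂ) 1 → (K.region D \ K.edgeRegion C : Set (V ⊕ K.facets → ℝ)))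
      (τ : (K.region D \ K.edgeRegion C : Set (V ⊕ K.facets → ℝ)) → Metric.ball (0 : ℂ) 1),
      Continuous σ ∧ Continuous τ ∧ ∀ x, σ (τ x) = x := by
  obtain ⟨e, he⟩ := h
  have hball : ∀ z : Metric.closedBall (0 : ℂ) 1,
      (z : ℂ) ∈ Metric.ball (0 : ℂ) 1 ↔ (z : ℂ) ∉ Metric.sphere (0 : ℂ) 1 := by
    intro z
    have := z.2
    simp only [Metric.mem_closedBall, dist_zero_right] at this
    simp only [Metric.mem_ball, Metric.mem_sphere, dist_zero_right]
    exact this.lt_iff_ne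
  refine ⟨fun z => ⟨e.symm ⟨z, Metric.ball_subset_closedBall z.2⟩, (e.symm _).2, ?_⟩,
    fun x => ⟨e ⟨x, x.2.1⟩, ?_⟩, ?_, ?_, ?_⟩
  · rw [← he, e.apply_symm_apply]
    exact (hball _).mp z.2
  · rw [hball, he]
    exact x.2.2
  · fun_prop
  · fun_prop
  · intro x
    simp

lemma BoundsDisc.isPreconnected_interior {C : K.graph.Subgraph} {D : Set K.facets}
    (h : K.BoundsDisc C D) : IsPreconnected (K.region D \ K.edgeRegion C) := by
  obtain ⟨σ, τ, hσ, -, hστ⟩ := h.interior_retract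
  have : PreconnectedSpace (Metric.ball (0 : ℂ) 1) :=
    Subtype.preconnectedSpace (convex_ball _ _).isPreconnected
  have hp := isPreconnected_range (continuous_subtype_val.comp hσ)
  rwa [Set.range_comp, (Function.RightInverse.surjective (g := τ) hστ).range_eq, Set.image_univ,
    Subtype.range_coe] at hp

lemma BoundsDisc.exists_log {C : K.graph.Subgraph} {D : Set K.facets} (h : K.BoundsDisc C D)
    {ψ : (K.region D \ K.edgeRegion C : Set (V ⊕ K.facets → ℝ)) → ℂ} (hψ : Continuous ψ)
    (h0 : ∀ x, ψ x ≠ 0) :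
    ∃ L : (K.region D \ K.edgeRegion C : Set (V ⊕ K.facets → ℝ)) → ℂ,
      Continuous L ∧ ∀ x, Complex.exp (L x) = ψ x := by
  obtain ⟨σ, τ, hσ, hτ, hστ⟩ := h.interior_retract
  have h0mem : (0 : ℂ) ∈ Metric.ball (0 : ℂ) 1 := by simp
  obtain ⟨L, hL, hexp⟩ := ((convex_ball (0 : ℂ) 1).starConvex h0mem).exists_continuous_log h0mem
    (hψ.comp hσ) fun z => h0 (σ z)
  refine ⟨fun x => L (τ x), by fun_prop, fun x => ?_⟩
  rw [hexp, Function.comp_apply, hστ]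

/-- An edge of the boundary cycle does not lie in two facets of the disc. -/
lemma BoundsDisc.eq_of_adj {C : K.graph.Subgraph} {D : Set K.facets} (h : K.BoundsDisc C D)
    (hK : K.IsPolyhedralMap) {u v : V} (huv : C.Adj u v) {f g : K.facets} (hf : f ∈ D)
    (hg : g ∈ D) (hfu : f.1.Adj u v) (hgu : g.1.Adj u v) : f = g := by
  by_contra hfg
  obtain ⟨e, he⟩ := h
  have hne : u ≠ v := huv.ne
  have hreg : ∀ j ∈ D, j.1.Adj u v → ∀ s : unitInterval, spoke j u v s ∈ K.region D :=
    fun j hj hju s => facetRegion_subset_region hj (spoke_mem hju s.2.1 s.2.2)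
  let x : K.region D := ⟨spoke f u v 1, hreg f hf hfu 1⟩
  have hxs : (e x : ℂ) ∈ Metric.sphere (0 : ℂ) 1 := by
    rw [he]
    refine ⟨u, v, huv, 1 / 2, 1 / 2, by norm_num, by norm_num, by norm_num, ?_⟩
    simp [x, spoke]
  -- Near the midpoint `x` of the edge both vertex coordinates are positive, so all points of the
  -- region lie in triangles over `uv`.
  let U : Set (K.region D) := {y | 0 < y.1 (Sum.inl u)} ∩ {y | 0 < y.1 (Sum.inl v)}
  have hUo : IsOpen U :=
    (isOpen_lt continuous_const (continuous_coord _)).inter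
      (isOpen_lt continuous_const (continuous_coord _))
  have hxU : x ∈ U := by
    refine ⟨?_, ?_⟩
    · change 0 < spoke f u v 1 _
      rw [spoke, combo_apply_left hne]; norm_num
    · change 0 < spoke f u v 1 _
      rw [spoke, combo_apply_right hne]; norm_num
  have hnhds : e.symm ⁻¹' U ∈ nhds (e x) :=
    e.symm.continuous.continuousAt.preimage_mem_nhds (by simpa using hUo.mem_nhds hxU)
  rw [nhds_subtype, Filter.mem_comap] at hnhds
  obtain ⟨N, hN, hNU⟩ := hnhds
  obtain ⟨ε, hε, hεN⟩ := Metric.mem_nhds_iff.mp hN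
  -- The part of the open disc near a boundary point is convex, hence connected. Pulled back, it
  -- misses the edge `uv`, so it would split into the open sets of positive `f`-coordinate and
  -- positive `g`-coordinate.
  let B : Set ℂ := Metric.ball (e x : ℂ) ε ∩ Metric.ball 0 1
  have hBc : IsPreconnected B := ((convex_ball _ _).inter (convex_ball _ _)).isPreconnected
  have hBcl : ∀ z : B, (z : ℂ) ∈ Metric.closedBall (0 : ℂ) 1 :=
    fun z => Metric.ball_subset_closedBall z.2.2
  let r : B → K.region D := fun z => e.symm ⟨z, hBcl z⟩
  have hr : Continuous r := by fun_prop
  have hrU : ∀ z, r z ∈ U := fun z => hNU (hεN z.2.1)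
  have hrC : ∀ z, (r z).1 ∉ K.edgeRegion C := fun z => by
    rw [← he, e.apply_symm_apply]
    have := z.2.2
    simp only [Metric.mem_ball, dist_zero_right] at this
    simp only [Metric.mem_sphere, dist_zero_right]
    exact this.ne
  have hBs : PreconnectedSpace B := Subtype.preconnectedSpace hBc
  let W : K.facets → Set B := fun j => {z | 0 < (r z).1 (Sum.inr j)}
  have hWo : ∀ j, IsOpen (W j) := fun j =>
    isOpen_lt continuous_const ((continuous_coord _).comp hr)
  have hcover : Set.univ ⊆ W f ∪ W g := by
    intro z _
    obtain ⟨j, hj, hzj⟩ := mem_region_iff.mp (r z).2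
    obtain ⟨hju, hsum, heq⟩ := mem_triangle hzj hne (hrU z).1 (hrU z).2
    have hpos : 0 < (r z).1 (Sum.inr j) := by
      refine lt_of_le_of_ne (coord_nonneg hzj _) fun h0 => hrC z ⟨u, v, huv, _, _,
        (hrU z).1.le, (hrU z).2.le, by linarith, ?_⟩
      conv_rhs => rw [heq]
      rw [← h0]
      simp
    rcases hK.eq_or_eq hfg hfu hgu hju with rfl | rfl
    · exact Or.inl hpos
    · exact Or.inr hpos
  -- Points of the spoke of `j` close to the midpoint.
  have hmeets : ∀ j ∈ D, j.1.Adj u v → (Set.univ ∩ W j).Nonempty := by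
    intro j hj hju
    let y : unitInterval → K.region D := fun s => ⟨spoke j u v s, hreg j hj hju s⟩
    have hy : Continuous y := by
      refine Continuous.subtype_mk ?_ _
      exact (continuous_spoke j u v).comp continuous_subtype_val
    have hy1 : y 1 = x := Subtype.ext (spoke_one j f u v)
    have hlim : Filter.Tendsto (fun s => (e (y s) : ℂ)) (nhdsWithin 1 {1}ᶜ) (nhds (e x)) := by
      rw [← hy1]
      exact ((by fun_prop : Continuous fun s => (e (y s) : ℂ)).tendsto 1).mono_left
        nhdsWithin_le_nhds
    obtain ⟨s, hs1, hs2⟩ := ((hlim.eventually (Metric.ball_mem_nhds _ hε)).and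
      self_mem_nhdsWithin).exists
    have hs1' : (s : ℝ) ≠ 1 := fun h => hs2 (Subtype.ext h)
    have hin : (e (y s) : ℂ) ∈ Metric.ball (0 : ℂ) 1 := by
      have h1 : (e (y s) : ℂ) ∉ Metric.sphere (0 : ℂ) 1 := by
        rw [he]
        exact spoke_notMem_edgeRegion hne (Or.inl hs1')
      have h2 := (e (y s)).2
      simp only [Metric.mem_closedBall, Metric.mem_sphere, Metric.mem_ball,
        dist_zero_right] at h1 h2 ⊢
      exact lt_of_le_of_ne h2 h1
    refine ⟨⟨e (y s), hs1, hin⟩, trivial, ?_⟩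
    change 0 < (e.symm (e (y s))).1 (Sum.inr j)
    rw [e.symm_apply_apply]
    change 0 < spoke j u v s _
    rw [spoke, combo_apply_centre]
    have := lt_of_le_of_ne s.2.2 hs1'
    linarith
  obtain ⟨z, -, hz1, hz2⟩ := hBs.isPreconnected_univ (W f) (W g) (hWo f) (hWo g) hcover
    (hmeets f hf hfu) (hmeets g hg hgu)
  obtain ⟨j, hj, hzj⟩ := mem_region_iff.mp (r z).2
  by_cases hjf : j = f
  · have := coord_inr_eq_zero hzj (g := g) (by rw [hjf]; exact Ne.symm hfg)
    exact hz2.ne' this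
  · exact hz1.ne' (coord_inr_eq_zero hzj (Ne.symm hjf))

/-- An edge of the disc that is not on the boundary lies in two of its facets. -/
lemma BoundsDisc.exists_other {C : K.graph.Subgraph} {D : Set K.facets} (h : K.BoundsDisc C D)
    {u v : V} (huv : ¬ C.Adj u v) {f : K.facets} (hf : f ∈ D) (hfu : f.1.Adj u v) :
    ∃ g ∈ D, g ≠ f ∧ g.1.Adj u v := by
  by_contra! hcon
  obtain ⟨e, he⟩ := h
  have hne : u ≠ v := hfu.ne
  let x : K.region D := ⟨spoke f u v 1, facetRegion_subset_region hf
    (spoke_mem hfu zero_le_one le_rfl)⟩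
  have hxs : (e x : ℂ) ∉ Metric.sphere (0 : ℂ) 1 := by
    rw [he]
    exact spoke_notMem_edgeRegion hne (Or.inr huv)
  have hxb : (e x : ℂ) ∈ Metric.ball (0 : ℂ) 1 := by
    have h2 := (e x).2
    simp only [Metric.mem_closedBall, Metric.mem_sphere, Metric.mem_ball,
      dist_zero_right] at hxs h2 ⊢
    exact lt_of_le_of_ne h2 hxs
  let U : Set (K.region D) := {y | 0 < y.1 (Sum.inl u)} ∩ {y | 0 < y.1 (Sum.inl v)}
  have hUo : IsOpen U :=
    (isOpen_lt continuous_const (continuous_coord _)).inter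
      (isOpen_lt continuous_const (continuous_coord _))
  have hxU : x ∈ U := by
    refine ⟨?_, ?_⟩
    · change 0 < spoke f u v 1 _
      rw [spoke, combo_apply_left hne]; norm_num
    · change 0 < spoke f u v 1 _
      rw [spoke, combo_apply_right hne]; norm_num
  have hnhds : e.symm ⁻¹' U ∈ nhds (e x) :=
    e.symm.continuous.continuousAt.preimage_mem_nhds (by simpa using hUo.mem_nhds hxU)
  rw [nhds_subtype, Filter.mem_comap] at hnhds
  obtain ⟨N, hN, hNU⟩ := hnhds
  obtain ⟨ε, hε, hεN⟩ := Metric.nhds_basis_closedBall.mem_iff.mp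
    (Filter.inter_mem hN (Metric.isOpen_ball.mem_nhds hxb))
  -- The triangle of `f` over `uv` without the midpoint `x` is star-shaped about the centre of `f`,
  -- since `x` lies on the opposite edge. So `e - e x` has a logarithm on it. If `f` is the only
  -- facet of `D` at `uv`, a small circle around the interior point `e x` pulls back into this set,
  -- which is impossible.
  let S : Set (V ⊕ K.facets → ℝ) :=
    convexHull ℝ {K.point (Sum.inl u), K.point (Sum.inl v), K.point (Sum.inr f)} \ {x.1}
  have hSreg : ∀ y ∈ S, y ∈ K.region D := fun y hy =>
    facetRegion_subset_region hf ⟨u, v, hfu, hy.1⟩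
  have hcS : K.point (Sum.inr f) ∈ S := by
    refine ⟨subset_convexHull ℝ _ (by simp), fun hx => ?_⟩
    have := congrFun (Set.mem_singleton_iff.mp hx) (Sum.inr f)
    change _ = spoke f u v 1 _ at this
    rw [spoke, combo_apply_centre, point_apply_self] at this
    norm_num at this
  have hstar : StarConvex ℝ (K.point (Sum.inr f)) S := by
    intro y hy a b ha hb hab
    refine ⟨convex_convexHull ℝ _ hcS.1 hy.1 ha hb hab, fun hx => hy.2 ?_⟩
    have hx' := congrFun (Set.mem_singleton_iff.mp hx) (Sum.inr f)
    have hyc := coord_nonneg (K := K) (f := f) ⟨u, v, hfu, hy.1⟩ (Sum.inr f)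
    change _ = spoke f u v 1 _ at hx'
    rw [spoke, combo_apply_centre] at hx'
    simp only [Pi.add_apply, Pi.smul_apply, point_apply_self, smul_eq_mul, mul_one, sub_self] at hx'
    have ha0 : a = 0 := by nlinarith [mul_nonneg hb hyc]
    have hb1 : b = 1 := by linarith
    rw [Set.mem_singleton_iff] at hx ⊢
    rw [ha0, hb1] at hx
    simpa using hx
  let ψ : S → ℂ := fun y => e ⟨y, hSreg y y.2⟩ - e x
  have hψ : Continuous ψ := by fun_prop
  have hψ0 : ∀ y, ψ y ≠ 0 := fun y h0 => by
    have h1 := e.injective (Subtype.ext (sub_eq_zero.mp h0))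
    exact y.2.2 (congrArg Subtype.val h1)
  obtain ⟨L, hL, hexp⟩ := hstar.exists_continuous_log hcS hψ hψ0
  have hball : ∀ z : Metric.sphere (0 : ℂ) 1, (e x : ℂ) + ε * z ∈ Metric.closedBall (e x : ℂ) ε := by
    intro z
    have h2 : ‖(z : ℂ)‖ = 1 := by simp
    simp [h2, abs_of_pos hε]
  have hcl : ∀ z : Metric.sphere (0 : ℂ) 1, (e x : ℂ) + ε * z ∈ Metric.closedBall (0 : ℂ) 1 :=
    fun z => Metric.ball_subset_closedBall (hεN (hball z)).2
  let r : Metric.sphere (0 : ℂ) 1 → K.region D := fun z => e.symm ⟨_, hcl z⟩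
  have hr : Continuous r := by fun_prop
  have hrS : ∀ z, (r z).1 ∈ S := by
    intro z
    have hzU : r z ∈ U := hNU (hεN (hball z)).1
    obtain ⟨j, hj, hzj⟩ := mem_region_iff.mp (r z).2
    obtain ⟨hju, hsum, heq⟩ := mem_triangle hzj hne hzU.1 hzU.2
    obtain rfl : j = f := by
      by_contra hjf
      exact hcon j hj hjf hju
    refine ⟨?_, fun hx => ?_⟩
    · rw [heq]
      have hmem : ∀ i, i ∈ ({K.point (Sum.inl u), K.point (Sum.inl v), K.point (Sum.inr j)} :
          Set (V ⊕ K.facets → ℝ)) → i ∈ convexHull ℝ {K.point (Sum.inl u), K.point (Sum.inl v),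
          K.point (Sum.inr j)} := fun i hi => subset_convexHull ℝ _ hi
      have := (convex_convexHull ℝ {K.point (Sum.inl u), K.point (Sum.inl v),
          K.point (Sum.inr j)}).sum_mem (t := Finset.univ)
          (w := ![(r z).1 (Sum.inl u), (r z).1 (Sum.inl v), (r z).1 (Sum.inr j)])
          (z := ![K.point (Sum.inl u), K.point (Sum.inl v), K.point (Sum.inr j)])
          (by
            intro i _
            fin_cases i
            exacts [coord_nonneg hzj _, coord_nonneg hzj _, coord_nonneg hzj _])
          (by simpa [Fin.sum_univ_three] using hsum)
          (by
            intro i _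
            fin_cases i
            exacts [hmem _ (by simp), hmem _ (by simp), hmem _ (by simp)])
      simpa only [Fin.sum_univ_three, Matrix.cons_val_zero, Matrix.cons_val_one,
        Matrix.cons_val] using this
    · have h1 : r z = x := Subtype.ext hx
      have h2 : (⟨_, hcl z⟩ : Metric.closedBall (0 : ℂ) 1) = e x :=
        (e.apply_symm_apply _).symm.trans (congrArg e h1)
      have h3 := congrArg Subtype.val h2
      have h4 : (ε : ℂ) * z = 0 := by simpa using h3
      have h5 : (z : ℂ) ≠ 0 := by
        have h2 : ‖(z : ℂ)‖ = 1 := by simp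
        intro h0; rw [h0] at h2; simp at h2
      exact (mul_ne_zero (by exact_mod_cast hε.ne') h5) h4
  refine not_exists_log_circle (L := fun z => L ⟨r z, hrS z⟩) (by fun_prop) hε fun z => ?_
  rw [hexp]
  change ((e (r z) : ℂ) - e x) = _
  rw [e.apply_symm_apply]
  simp

end PolygonalComplex

/-! ### Global topology: boundary edges, connectedness and separation. -/

namespace PolygonalComplex

variable {V : Type*} {K : PolygonalComplex V}

lemma drawing_re [Finite V] (t : V → ℝ) (a b : V) (α β : ℝ) :
    (K.drawing t (α • K.point (Sum.inl a) + β • K.point (Sum.inl b))).re = α * t a + β * t b := by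
  simp [drawing_point, position, parabola]

/-- The drawing of a path in the line is injective. -/
lemma eq_of_consec_of_drawing_re_eq [Finite V] {t : V → ℝ} {l : List V}
    (hl : l.Pairwise (t · < t ·)) {a b a' b' : V} (hab : l.Consec a b) (hab' : l.Consec a' b')
    {x x' : V ⊕ K.facets → ℝ} (hx : x ∈ segment ℝ (K.point (Sum.inl a)) (K.point (Sum.inl b)))
    (hx' : x' ∈ segment ℝ (K.point (Sum.inl a')) (K.point (Sum.inl b')))
    (h : (K.drawing t x).re = (K.drawing t x').re) : x = x' := by
  obtain ⟨α, β, hα, hβ, hαβ, rfl⟩ := hx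
  obtain ⟨α', β', hα', hβ', hαβ', rfl⟩ := hx'
  rw [drawing_re, drawing_re] at h
  have hlt := hab.lt hl
  have hlt' := hab'.lt hl
  have key : ∀ a b a' b' : V, l.Consec a b → l.Consec a' b' → t a < t b → t a' < t b' →
      ∀ α β α' β' : ℝ, 0 ≤ α → 0 ≤ β → 0 ≤ α' → 0 ≤ β' → α + β = 1 → α' + β' = 1 →
      α * t a + β * t b = α' * t a' + β' * t b' → t b ≤ t a' →
      α • K.point (Sum.inl a) + β • K.point (Sum.inl b) =
        α' • K.point (Sum.inl a') + β' • K.point (Sum.inl b') := by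
    intro a b a' b' hab hab' hlt hlt' α β α' β' hα hβ hα' hβ' hαβ hαβ' h hba
    obtain rfl : β = 1 - α := by linarith
    obtain rfl : α' = 1 - β' := by linarith
    have h1 := mul_nonneg hα (sub_nonneg.mpr hlt.le)
    have h2 := mul_nonneg hβ' (sub_nonneg.mpr hlt'.le)
    have hα0 : α * (t b - t a) = 0 := by nlinarith
    have hβ0 : β' * (t b' - t a') = 0 := by nlinarith
    have hα0' := (mul_eq_zero.mp hα0).resolve_right (sub_pos.mpr hlt).ne'
    have hβ0' := (mul_eq_zero.mp hβ0).resolve_right (sub_pos.mpr hlt').ne'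
    subst hα0' hβ0'
    obtain rfl : b = a' := injOn_of_pairwise_lt hl hab.mem_right hab'.mem_left (by linarith)
    simp
  rcases hab.le_or_le hl hab'.mem_left with h1 | h1
  · rcases hab'.le_or_le hl hab.mem_left with h2 | h2
    · obtain rfl : a = a' := injOn_of_pairwise_lt hl hab.mem_left hab'.mem_left (by linarith)
      have hb : t b = t b' := by
        apply le_antisymm
        · exact (hab.le_or_le hl hab'.mem_right).resolve_left (by linarith)
        · exact (hab'.le_or_le hl hab.mem_right).resolve_left (by linarith)
      obtain rfl : b = b' := injOn_of_pairwise_lt hl hab.mem_right hab'.mem_right hb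
      have h3 : (α - α') * (t a - t b) = 0 := by
        obtain rfl : β = 1 - α := by linarith
        obtain rfl : β' = 1 - α' := by linarith
        linarith
      have h4 : α = α' := by
        have := (mul_eq_zero.mp h3).resolve_right (by linarith)
        linarith
      rw [h4, show β = β' by linarith]
    · exact (key a' b' a b hab' hab hlt' hlt α' β' α β hα' hβ' hα hβ hαβ' hαβ h.symm h2).symm
  · exact key a b a' b' hab hab' hlt hlt' α β α' β' hα hβ hα' hβ' hαβ hαβ' h h1

/-- Each edge of the boundary cycle lies in a facet of the disc. -/
lemma BoundsDisc.exists_adj [Finite V] {C : K.graph.Subgraph} {D : Set K.facets}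
    (h : K.BoundsDisc C D) (hC : C.IsCycleGraph) {u v : V} (huv : C.Adj u v) :
    ∃ f ∈ D, f.1.Adj u v := by
  classical
  by_contra! hcon
  obtain ⟨e, he⟩ := h
  obtain ⟨p, hp, hlen, -, hv, hadj⟩ := hC.exists_path huv
  set t : V → ℝ := fun w => p.support.idxOf w
  have hl : p.support.Pairwise (t · < t ·) := pairwise_idxOf hp.support_nodup
  have hend : ∀ w, w = u ∨ w = v → ∃ a b, p.support.Consec a b ∧
      K.point (Sum.inl w) ∈ segment ℝ (K.point (Sum.inl a)) (K.point (Sum.inl b)) := by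
    intro w hw
    have hw' : w ∈ C.verts := by
      rcases hw with rfl | rfl
      · exact huv.fst_mem
      · exact huv.snd_mem
    obtain ⟨w', hww'⟩ : ∃ w', s(w, w') ∈ p.edges := by
      rw [← hv] at hw'
      have hnn : ¬ p.Nil := by rw [Walk.not_nil_iff_lt_length]; omega
      obtain ⟨e, he, hwe⟩ := (Walk.mem_support_iff_exists_mem_edges_of_not_nil hnn).mp hw'
      exact ⟨_, by rwa [Sym2.other_spec hwe]⟩
    rcases (p.consec_support_iff w w').mp hww' with h | h
    · exact ⟨w, w', h, left_mem_segment _ _ _⟩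
    · exact ⟨w', w, h, right_mem_segment _ _ _⟩
  -- Without a facet of `D` at `uv`, the part of the region on `C` lies on the path `C` minus `uv`.
  -- The abscissa of the drawing embeds this path in the line, but the preimage of the unit circle
  -- lies in it.
  have hseg : ∀ x ∈ K.region D, x ∈ K.edgeRegion C → ∃ a b, p.support.Consec a b ∧
      x ∈ segment ℝ (K.point (Sum.inl a)) (K.point (Sum.inl b)) := by
    rintro x hx ⟨a, b, hab, hxab⟩
    rcases (hadj a b).mp hab with h | h
    · rcases (p.consec_support_iff a b).mp h with h | h
      · exact ⟨a, b, h, hxab⟩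
      · exact ⟨b, a, h, by rwa [segment_symm]⟩
    obtain ⟨j, hj, hxj⟩ := mem_region_iff.mp hx
    have hjab : ¬ j.1.Adj a b := by
      rw [← Subgraph.mem_edgeSet, h, Subgraph.mem_edgeSet]
      exact hcon j hj
    obtain ⟨α, β, hα, hβ, hαβ, rfl⟩ := hxab
    have hca := combo_apply_left hab.ne j α β 0
    have hcb := combo_apply_right hab.ne j α β 0
    rw [zero_smul, add_zero] at hca hcb
    have hmem : (a = u ∨ a = v) ∧ (b = u ∨ b = v) := by
      rcases Sym2.eq_iff.mp h with ⟨rfl, rfl⟩ | ⟨rfl, rfl⟩ <;> simp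
    rcases hα.eq_or_lt with h0 | h0
    · rw [← h0, show β = 1 by linarith]
      simpa using hend b hmem.2
    rcases hβ.eq_or_lt with h1 | h1
    · rw [← h1, show α = 1 by linarith]
      simpa using hend a hmem.1
    · exact absurd (mem_triangle hxj hab.ne (by rwa [hca]) (by rwa [hcb])).1 hjab
  let r : Metric.sphere (0 : ℂ) 1 → K.region D :=
    fun z => e.symm ⟨z, Metric.sphere_subset_closedBall z.2⟩
  have hr : Continuous r := by fun_prop
  have hrC : ∀ z, (r z).1 ∈ K.edgeRegion C := fun z => by
    rw [← he, e.apply_symm_apply]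
    exact z.2
  refine not_injective_of_sphere (φ := fun z => (K.drawing t (r z)).re)
    (Complex.continuous_re.comp ((continuous_drawing t).comp (continuous_subtype_val.comp hr)))
    fun z z' hzz' => ?_
  obtain ⟨a, b, hab, hz⟩ := hseg _ (r z).2 (hrC z)
  obtain ⟨a', b', hab', hz'⟩ := hseg _ (r z').2 (hrC z')
  have h1 : r z = r z' := Subtype.ext (eq_of_consec_of_drawing_re_eq hl hab hab' hz hz' hzz')
  have h2 := congrArg Subtype.val (e.symm.injective h1)
  exact Subtype.ext h2

/-- The facets of a disc all of whose vertices lie on its boundary are connected through common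
edges. -/
lemma BoundsDisc.exists_adj_of_partition [Finite V] {C : K.graph.Subgraph} {D : Set K.facets}
    (h : K.BoundsDisc C D) (hV : ∀ v, ∃ w, C.Adj v w) (S : Set K.facets) {f g : K.facets}
    (hf : f ∈ D) (hfS : f ∈ S) (hg : g ∈ D) (hgS : g ∉ S) :
    ∃ j ∈ D, ∃ j' ∈ D, j ∈ S ∧ j' ∉ S ∧ ∃ a b, j.1.Adj a b ∧ j'.1.Adj a b := by
  by_contra! hcon
  have hcentre : ∀ j ∈ D, K.point (Sum.inr j) ∈ K.region D \ K.edgeRegion C := fun j hj =>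
    ⟨facetRegion_subset_region hj (centre_mem_facetRegion j), fun hmem => by
      have := coord_inr_of_mem_edgeRegion hmem j
      rw [point_apply_self] at this
      exact one_ne_zero this⟩
  have hcover : K.region D \ K.edgeRegion C ⊆ K.region (D ∩ S) ∪ K.region (D \ S) := by
    rintro x ⟨hx, -⟩
    obtain ⟨j, hj, hxj⟩ := mem_region_iff.mp hx
    by_cases hjS : j ∈ S
    · exact Or.inl (mem_region_iff.mpr ⟨j, ⟨hj, hjS⟩, hxj⟩)
    · exact Or.inr (mem_region_iff.mpr ⟨j, ⟨hj, hjS⟩, hxj⟩)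
  -- Two closed sets cover the connected interior, so some point lies in a facet of each class. Its
  -- centre coordinates vanish there, and it is no vertex because all vertices lie on `C`; so it is
  -- inside a common edge.
  obtain ⟨x, hx, hx1, hx2⟩ := isPreconnected_closed_iff.mp h.isPreconnected_interior
    (K.region (D ∩ S)) (K.region (D \ S)) (isCompact_region _).isClosed
    (isCompact_region _).isClosed hcover
    ⟨_, hcentre f hf, facetRegion_subset_region (D := D ∩ S) ⟨hf, hfS⟩ (centre_mem_facetRegion f)⟩
    ⟨_, hcentre g hg, facetRegion_subset_region (D := D \ S) ⟨hg, hgS⟩ (centre_mem_facetRegion g)⟩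
  obtain ⟨j, hj, hxj⟩ := mem_region_iff.mp hx1
  obtain ⟨j', hj', hxj'⟩ := mem_region_iff.mp hx2
  have hjj' : j ≠ j' := fun h => hj'.2 (h ▸ hj.2)
  have hc0 := coord_inr_eq_zero hxj' hjj'
  obtain ⟨a, b, α, β, c, hab, hα, hβ, hc, hsum, hxeq⟩ := mem_facetRegion_iff.mp hxj
  have hca := combo_apply_left hab.ne j α β c
  have hcb := combo_apply_right hab.ne j α β c
  have hcc := combo_apply_centre a b j α β c
  rw [← hxeq] at hca hcb hcc
  obtain rfl : c = 0 := hcc.symm.trans hc0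
  have hvert : ∀ w, K.point (Sum.inl w) ∈ K.edgeRegion C := fun w => by
    obtain ⟨w', hw⟩ := hV w
    exact ⟨w, w', hw, left_mem_segment _ _ _⟩
  have hone : ∀ w, x (Sum.inl w) ≠ 1 := fun w hw =>
    hx.2 (eq_point_of_coord_eq_one hxj hw ▸ hvert w)
  have hα0 : 0 < α := by
    refine lt_of_le_of_ne hα fun h0 => hone b ?_
    rw [hcb]; linarith
  have hβ0 : 0 < β := by
    refine lt_of_le_of_ne hβ fun h0 => hone a ?_
    rw [hca]; linarith
  exact hcon j hj.1 j' hj'.1 hj.2 hj'.2 a b hab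
    (mem_triangle hxj' hab.ne (by rwa [hca]) (by rwa [hcb])).1

/-- A function on the surface that winds once around the origin when the edge `u v` is crossed from
the facet `f` to the facet `g`, and is positive on the other edges. -/
noncomputable def crossing (f g : K.facets) (u v : V) (x : V ⊕ K.facets → ℝ) : ℂ :=
  ((1 - x (Sum.inl u) - x (Sum.inl v) - min (x (Sum.inl u)) (x (Sum.inl v)) : ℝ) : ℂ) +
    ((min (min (x (Sum.inl u)) (x (Sum.inl v))) (x (Sum.inr f)) -
      min (min (x (Sum.inl u)) (x (Sum.inl v))) (x (Sum.inr g)) : ℝ) : ℂ) * Complex.I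

lemma crossing_re (f g : K.facets) (u v : V) (x : V ⊕ K.facets → ℝ) :
    (crossing f g u v x).re =
      1 - x (Sum.inl u) - x (Sum.inl v) - min (x (Sum.inl u)) (x (Sum.inl v)) := by
  rw [crossing, Complex.add_re, Complex.ofReal_re, Complex.re_ofReal_mul, Complex.I_re, mul_zero,
    add_zero]

lemma crossing_im (f g : K.facets) (u v : V) (x : V ⊕ K.facets → ℝ) :
    (crossing f g u v x).im =
      min (min (x (Sum.inl u)) (x (Sum.inl v))) (x (Sum.inr f)) -
        min (min (x (Sum.inl u)) (x (Sum.inl v))) (x (Sum.inr g)) := by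
  rw [crossing, Complex.add_im, Complex.ofReal_im, Complex.im_ofReal_mul, Complex.I_im, mul_one,
    zero_add]

lemma continuous_crossing (f g : K.facets) (u v : V) : Continuous (crossing f g u v) := by
  unfold crossing
  fun_prop

/-- If one of the coordinates at `u`, `v` is zero, the real part is 1 minus the other. If both are
positive, the point lies in a triangle of `f` or `g` over `uv`; vanishing of the real part makes the
centre coordinate equal to the minimum, so the imaginary part is plus or minus this minimum. -/
lemma crossing_ne_zero (hK : K.IsPolyhedralMap) {f g : K.facets} (hfg : f ≠ g) {u v : V}
    (hfu : f.1.Adj u v) (hgu : g.1.Adj u v) {j : K.facets} {x : V ⊕ K.facets → ℝ}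
    (hx : x ∈ K.facetRegion j) (hone : ∀ w, x (Sum.inl w) ≠ 1) : crossing f g u v x ≠ 0 := by
  intro h0
  have hre := congrArg Complex.re h0
  have him := congrArg Complex.im h0
  rw [crossing_re, Complex.zero_re] at hre
  rw [crossing_im, Complex.zero_im] at him
  rcases (coord_nonneg hx (Sum.inl u)).eq_or_lt with hu | hu
  · rw [← hu, min_eq_left (coord_nonneg hx _)] at hre
    exact hone v (by linarith)
  rcases (coord_nonneg hx (Sum.inl v)).eq_or_lt with hv | hv
  · rw [← hv, min_eq_right (coord_nonneg hx _)] at hre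
    exact hone u (by linarith)
  obtain ⟨hju, hsum, -⟩ := mem_triangle hx hfu.ne hu hv
  have hm : 0 < min (x (Sum.inl u)) (x (Sum.inl v)) := lt_min hu hv
  have hxj : x (Sum.inr j) = min (x (Sum.inl u)) (x (Sum.inl v)) := by linarith
  rcases hK.eq_or_eq hfg hfu hgu hju with rfl | rfl
  · rw [coord_inr_eq_zero hx hfg.symm, hxj, min_self, min_eq_right hm.le] at him
    linarith
  · rw [coord_inr_eq_zero hx hfg, hxj, min_self, min_eq_right hm.le] at him
    linarith

lemma spoke_apply_nonneg (j : K.facets) (a b : V) {s : ℝ} (h0 : 0 ≤ s) (h1 : s ≤ 1)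
    (i : V ⊕ K.facets) : 0 ≤ spoke j a b s i := by
  have e1 := point_apply_nonneg (K := K) (Sum.inl a) i
  have e2 := point_apply_nonneg (K := K) (Sum.inl b) i
  have e3 := point_apply_nonneg (K := K) (Sum.inr j) i
  have e4 : 0 ≤ 1 - s := by linarith
  simp only [spoke, Pi.add_apply, Pi.smul_apply, smul_eq_mul]
  positivity

lemma spoke_apply_le (j : K.facets) {a b : V} (hab : a ≠ b) {s : ℝ} (h1 : s ≤ 1) (w : V) :
    spoke j a b s (Sum.inl w) ≤ 1 / 2 := by
  unfold spoke
  by_cases ha : w = a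
  · subst ha
    rw [combo_apply_left hab]; linarith
  by_cases hb : w = b
  · subst hb
    rw [combo_apply_right hab]; linarith
  rw [combo_apply_of_ne ha hb]; norm_num

/-- An edge between two facets of the disc separates it. -/
lemma BoundsDisc.exists_potential {C : K.graph.Subgraph} {D : Set K.facets}
    (h : K.BoundsDisc C D) (hK : K.IsPolyhedralMap) (hV : ∀ v, ∃ w, C.Adj v w) {f g : K.facets}
    (hfg : f ≠ g) (hf : f ∈ D) (hg : g ∈ D) {u v : V} (hfu : f.1.Adj u v) (hgu : g.1.Adj u v)
    (huv : ¬ C.Adj u v) :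
    ∃ N : K.facets → ℝ, N f ≠ N g ∧ ∀ j ∈ D, ∀ j' ∈ D, ∀ a b, j.1.Adj a b → j'.1.Adj a b →
      ¬ C.Adj a b → s(a, b) ≠ s(u, v) → N j = N j' := by
  classical
  set X : Set (V ⊕ K.facets → ℝ) := K.region D \ K.edgeRegion C with hX
  have hψc : Continuous fun x : X => crossing f g u v x :=
    (continuous_crossing f g u v).comp continuous_subtype_val
  have hψ0 : ∀ x : X, crossing f g u v x ≠ 0 := by
    intro x
    obtain ⟨j, hj, hxj⟩ := mem_region_iff.mp x.2.1
    refine crossing_ne_zero hK hfg hfu hgu hxj fun w hw => x.2.2 ?_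
    obtain ⟨w', hww'⟩ := hV w
    rw [eq_point_of_coord_eq_one hxj hw]
    exact ⟨w, w', hww', left_mem_segment _ _ _⟩
  obtain ⟨L, hL, hexp⟩ := h.exists_log hψc hψ0
  have hmem : ∀ j ∈ D, ∀ a b, j.1.Adj a b → ¬ C.Adj a b → ∀ s ∈ Set.Icc (0 : ℝ) 1,
      spoke j a b s ∈ X := fun j hj a b hab hC s hs =>
    ⟨facetRegion_subset_region hj (spoke_mem hab hs.1 hs.2),
      spoke_notMem_edgeRegion hab.ne (Or.inr hC)⟩
  have hcentre : ∀ j ∈ D, K.point (Sum.inr j) ∈ X := fun j hj =>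
    ⟨facetRegion_subset_region hj (centre_mem_facetRegion j), fun hmem => by
      have := coord_inr_of_mem_edgeRegion hmem j
      rw [point_apply_self] at this
      exact one_ne_zero this⟩
  -- along a spoke on which `crossing` avoids a ray, `L` follows a branch of the logarithm
  have hspoke : ∀ j (hj : j ∈ D) a b (hab : j.1.Adj a b) (hC : ¬ C.Adj a b) (c : ℂ), c ≠ 0 →
      (∀ s ∈ Set.Icc (0 : ℝ) 1, c * crossing f g u v (spoke j a b s) ∈ Complex.slitPlane) →
      (L ⟨_, hcentre j hj⟩).im - (c * crossing f g u v (K.point (Sum.inr j))).arg =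
        (L ⟨_, hmem j hj a b hab hC 1 ⟨zero_le_one, le_rfl⟩⟩).im -
          (c * crossing f g u v (spoke j a b 1)).arg := by
    intro j hj a b hab hC c hc hs
    have hpre : IsPreconnected ((Subtype.val : X → _) ⁻¹' (spoke j a b '' Set.Icc 0 1)) := by
      rw [← Topology.IsInducing.subtypeVal.isPreconnected_image, Set.image_preimage_eq_of_subset]
      · exact isPreconnected_Icc.image _ (continuous_spoke j a b).continuousOn
      · rw [Subtype.range_coe]
        rintro _ ⟨s, hs, rfl⟩
        exact hmem j hj a b hab hC s hs
    have := im_sub_arg_eq hpre hL.continuousOn hc (x := ⟨_, hcentre j hj⟩)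
      (y := ⟨_, hmem j hj a b hab hC 1 ⟨zero_le_one, le_rfl⟩⟩) ?_
      ⟨0, ⟨le_rfl, zero_le_one⟩, spoke_zero j a b⟩ ⟨1, ⟨zero_le_one, le_rfl⟩, rfl⟩
    · rwa [hexp, hexp] at this
    · rintro x ⟨s, hs', hx⟩
      rw [hexp, ← hx]
      exact hs s hs'
  have hψcentre : ∀ j, crossing f g u v (K.point (Sum.inr j)) = 1 := by
    intro j
    have e1 := point_apply_nonneg (K := K) (Sum.inr j) (Sum.inr f)
    have e2 := point_apply_nonneg (K := K) (Sum.inr j) (Sum.inr g)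
    apply Complex.ext
    · rw [crossing_re]; simp
    · rw [crossing_im]; simp [e1, e2]
  -- The potential is the imaginary part of a logarithm of `crossing` at the facet centres, where
  -- `crossing` is 1. From the centre of `f` to the midpoint of `uv` the values go from 1 to -1/2
  -- through the upper half-plane, from `g` through the lower one, so the potentials differ by `2π`.
  -- Across any other inner edge the real part stays positive and nothing changes.
  refine ⟨fun j => if hj : j ∈ D then (L ⟨_, hcentre j hj⟩).im else 0, ?_, ?_⟩
  · simp only [hf, hg, dite_true]
    have hmid : ∀ j : K.facets, crossing f g u v (spoke j u v 1) = ((-1 / 2 : ℝ) : ℂ) := by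
      intro j
      have e1 : ∀ i : K.facets, spoke j u v 1 (Sum.inr i) = 0 := fun i => by simp [spoke]
      have e2 : spoke j u v 1 (Sum.inl u) = 1 / 2 := by
        rw [spoke, combo_apply_left hfu.ne]
      have e3 : spoke j u v 1 (Sum.inl v) = 1 / 2 := by
        rw [spoke, combo_apply_right hfu.ne]
      apply Complex.ext
      · rw [crossing_re, e2, e3, Complex.ofReal_re]; norm_num
      · rw [crossing_im, e1, e1, Complex.ofReal_im, sub_self]
    have e2 : ∀ (j : K.facets) (s : ℝ), spoke j u v s (Sum.inl u) = s / 2 := fun j s => by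
      rw [spoke, combo_apply_left hfu.ne]
    have e3 : ∀ (j : K.facets) (s : ℝ), spoke j u v s (Sum.inl v) = s / 2 := fun j s => by
      rw [spoke, combo_apply_right hfu.ne]
    have e4 : ∀ (j : K.facets) (s : ℝ), spoke j u v s (Sum.inr j) = 1 - s := fun j s => by
      rw [spoke, combo_apply_centre]
    have e5 : ∀ (i j : K.facets) (s : ℝ), i ≠ j → spoke j u v s (Sum.inr i) = 0 :=
      fun i j s hij => by
        simp [spoke, point_apply_of_ne (i := Sum.inr j) (j := Sum.inr i) (by simpa using hij)]
    have hslit : ∀ s ∈ Set.Icc (0 : ℝ) 1, ∀ A B : ℝ, A = 1 - s / 2 - s / 2 - s / 2 →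
        B = min (s / 2) (1 - s) → 0 < B ∨ A ≠ 0 := by
      rintro s ⟨h0, h1⟩ A B rfl rfl
      by_contra! hcon
      rcases min_le_iff.mp hcon.1 with h | h <;> linarith [hcon.2]
    -- The factor `-I` moves the cut to the negative imaginary axis, away from the upper half-plane;
    -- for `g` the factor is `I`.
    have hF := hspoke f hf u v hfu huv (-Complex.I) (by simp) (by
      intro s hs
      rw [Complex.mem_slitPlane_iff]
      have := hslit s hs _ _ rfl rfl
      rcases this with h | h
      · left
        simp only [Complex.mul_re, Complex.neg_re, Complex.neg_im, Complex.I_re, Complex.I_im,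
          crossing_im, crossing_re, e2, e3, e4, e5 g f s hfg.symm, min_self]
        rw [min_eq_right (by linarith [hs.1] : (0 : ℝ) ≤ s / 2)]
        linarith
      · right
        simp only [Complex.mul_im, Complex.neg_re, Complex.neg_im, Complex.I_re, Complex.I_im,
          crossing_im, crossing_re, e2, e3, e4, e5 g f s hfg.symm, min_self]
        intro h'
        apply h
        linarith)
    have hG := hspoke g hg u v hgu huv Complex.I (by simp) (by
      intro s hs
      rw [Complex.mem_slitPlane_iff]
      have := hslit s hs _ _ rfl rfl
      rcases this with h | h
      · left
        simp only [Complex.mul_re, Complex.I_re, Complex.I_im,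
          crossing_im, crossing_re, e2, e3, e4, e5 f g s hfg, min_self]
        rw [min_eq_right (by linarith [hs.1] : (0 : ℝ) ≤ s / 2)]
        linarith
      · right
        simp only [Complex.mul_im, Complex.I_re, Complex.I_im,
          crossing_im, crossing_re, e2, e3, e4, e5 f g s hfg, min_self]
        intro h'
        apply h
        linarith)
    have a1 : (-Complex.I * ((-1 / 2 : ℝ) : ℂ)).arg = Real.pi / 2 := by
      rw [show -Complex.I * ((-1 / 2 : ℝ) : ℂ) = ((1 / 2 : ℝ) : ℂ) * Complex.I by
        push_cast; ring, Complex.arg_real_mul _ (by norm_num), Complex.arg_I]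
    have a2 : (Complex.I * ((-1 / 2 : ℝ) : ℂ)).arg = -(Real.pi / 2) := by
      rw [show Complex.I * ((-1 / 2 : ℝ) : ℂ) = ((1 / 2 : ℝ) : ℂ) * -Complex.I by
        push_cast; ring, Complex.arg_real_mul _ (by norm_num), Complex.arg_neg_I]
    rw [hψcentre, hmid, a1, mul_one, Complex.arg_neg_I] at hF
    rw [hψcentre, hmid, a2, mul_one, Complex.arg_I] at hG
    have hLL : L ⟨_, hmem f hf u v hfu huv 1 ⟨zero_le_one, le_rfl⟩⟩ =
        L ⟨_, hmem g hg u v hgu huv 1 ⟨zero_le_one, le_rfl⟩⟩ :=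
      congrArg L (Subtype.ext (spoke_one f g u v))
    rw [hLL] at hF
    intro heq
    have := Real.pi_pos
    linarith
  · intro j hj j' hj' a b hab hab' hC hne
    simp only [hj, hj', dite_true]
    have hpos : ∀ i : K.facets, ∀ s ∈ Set.Icc (0 : ℝ) 1,
        1 * crossing f g u v (spoke i a b s) ∈ Complex.slitPlane := by
      intro i s hs
      rw [one_mul, Complex.mem_slitPlane_iff, crossing_re]
      left
      have hu := spoke_apply_le i hab.ne hs.2 u
      have hv := spoke_apply_le i hab.ne hs.2 v
      have hu0 := spoke_apply_nonneg i a b hs.1 hs.2 (Sum.inl u)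
      have hv0 := spoke_apply_nonneg i a b hs.1 hs.2 (Sum.inl v)
      -- One end of `uv` is off the edge `ab`; its coordinate vanishes, and the real part is at
      -- least 1/2.
      have hor : (u ≠ a ∧ u ≠ b) ∨ (v ≠ a ∧ v ≠ b) := by
        by_contra! hcon
        apply hne
        rw [Sym2.eq_iff]
        have := hfu.ne
        grind
      rcases hor with ho | ho
      · have : spoke i a b s (Sum.inl u) = 0 := combo_apply_of_ne ho.1 ho.2 ..
        rw [this] at hu0 ⊢
        rw [min_eq_left hv0]
        linarith
      · have : spoke i a b s (Sum.inl v) = 0 := combo_apply_of_ne ho.1 ho.2 ..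
        rw [this] at hv0 ⊢
        rw [min_eq_right hu0]
        linarith
    have h1 := hspoke j hj a b hab hC 1 one_ne_zero (hpos j)
    have h2 := hspoke j' hj' a b hab' hC 1 one_ne_zero (hpos j')
    rw [hψcentre] at h1 h2
    have hLL : L ⟨_, hmem j hj a b hab hC 1 ⟨zero_le_one, le_rfl⟩⟩ =
        L ⟨_, hmem j' hj' a b hab' hC 1 ⟨zero_le_one, le_rfl⟩⟩ :=
      congrArg L (Subtype.ext (spoke_one j j' a b))
    rw [hLL, spoke_one j j' a b] at h1
    linarith

end PolygonalComplex

/-! ### A contractible Hamiltonian cycle yields a proper tree. -/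

namespace PolygonalComplex

variable {V : Type*} {K : PolygonalComplex V}

/-- The spanning cycle `C` consists of the edges that lie in exactly one facet of `D`. -/
structure IsSpanningBoundary (K : PolygonalComplex V) (C : K.graph.Subgraph) (D : Set K.facets) :
    Prop where
  isCycleGraph : C.IsCycleGraph
  mem_verts : ∀ v, v ∈ C.verts
  ncard_neighborSet : ∀ v, (C.neighborSet v).ncard = 2
  exists_facet : ∀ {u v}, C.Adj u v → ∃ f ∈ D, f.1.Adj u v
  facet_unique : ∀ {u v}, C.Adj u v → ∀ {f g : K.facets}, f ∈ D → g ∈ D → f.1.Adj u v →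
    g.1.Adj u v → f = g
  exists_other : ∀ {u v}, ¬ C.Adj u v → ∀ {f : K.facets}, f ∈ D → f.1.Adj u v →
    ∃ g ∈ D, g ≠ f ∧ g.1.Adj u v

lemma BoundsDisc.isSpanningBoundary [Finite V] [DecidableEq V] (hK : K.IsPolyhedralMap) {a : V}
    {w : K.graph.Walk a a} (hw : w.IsHamiltonianCycle) {D : Set K.facets}
    (h : K.BoundsDisc w.toSubgraph D) : K.IsSpanningBoundary w.toSubgraph D where
  isCycleGraph := ⟨a, w, hw.isCycle, rfl⟩
  mem_verts v := by rw [Walk.mem_verts_toSubgraph]; exact hw.mem_support v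
  ncard_neighborSet v := hw.isCycle.ncard_neighborSet_toSubgraph_eq_two (hw.mem_support v)
  exists_facet huv := h.exists_adj ⟨a, w, hw.isCycle, rfl⟩ huv
  facet_unique huv _ _ hf hg hfu hgu := h.eq_of_adj hK huv hf hg hfu hgu
  exists_other huv _ hf hfu := h.exists_other huv hf hfu

namespace IsSpanningBoundary

variable {C : K.graph.Subgraph} {D : Set K.facets} (h : K.IsSpanningBoundary C D)
include h

lemma exists_adj (v : V) : ∃ w, C.Adj v w := h.isCycleGraph.exists_adj (h.mem_verts v)

lemma mem_of_mem (hK : K.IsPolyhedralMap) {u v : V} (huv : ¬ C.Adj u v) {f g : K.facets}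
    (hfg : f ≠ g) (hf : f ∈ D) (hfu : f.1.Adj u v) (hgu : g.1.Adj u v) : g ∈ D := by
  obtain ⟨j, hj, hjf, hju⟩ := h.exists_other huv hf hfu
  rcases hK.eq_or_eq hfg hfu hgu hju with rfl | rfl
  · exact absurd rfl hjf
  · exact hj

/-- At each vertex there is a boundary edge, with one facet inside and one facet outside. -/
lemma exists_in_out (hK : K.IsPolyhedralMap) (v : V) :
    ∃ u, C.Adj v u ∧ ∃ a ∈ D, ∃ b ∉ D, a.1.Adj v u ∧ b.1.Adj v u := by
  obtain ⟨u, hu⟩ := h.exists_adj v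
  obtain ⟨a, ha, hau⟩ := h.exists_facet hu
  obtain ⟨b, hba, hbu⟩ := hK.exists_other hau
  exact ⟨u, hu, a, ha, b, fun hb => hba (h.facet_unique hu hb ha hbu hau), hau, hbu⟩

/-- The number of edges of a facet that are not on the boundary is its number of neighbours in
the disc. -/
lemma ncard_diff (hK : K.IsPolyhedralMap) {f : K.facets} (hf : f ∈ D) :
    (((⊤ : K.dualGraph.Subgraph).induce D).neighborSet f).ncard =
      (f.1.edgeSet \ C.edgeSet).ncard := by
  have hshare : ∀ g ∈ ((⊤ : K.dualGraph.Subgraph).induce D).neighborSet f,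
      ∃ e, e ∈ f.1.edgeSet ∧ e ∈ g.1.edgeSet := by
    rintro g ⟨-, -, -, u, v, hf, hg⟩
    exact ⟨s(u, v), hf, hg⟩
  choose φ hφf hφg using hshare
  refine Set.ncard_congr φ ?_ ?_ ?_
  · intro g hg
    have h1 := hφf g hg
    have h2 := hφg g hg
    refine ⟨h1, ?_⟩
    revert h1 h2
    induction φ g hg with
    | _ u v =>
      intro h1 h2 h3
      exact hg.2.2.1 (h.facet_unique h3 hf hg.2.1 h1 h2)
  · intro g g' hg hg' he
    have h1 := hφf g hg
    have h2 := hφg g hg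
    have h3 := hφg g' hg'
    rw [← he] at h3
    revert h1 h2 h3
    induction φ g hg with
    | _ u v =>
      intro h1 h2 h3
      rcases hK.eq_or_eq hg.2.2.1 h1 h2 h3 with h | h
      · exact absurd h.symm hg'.2.2.1
      · exact h.symm
  · intro e he
    induction e with
    | _ u v =>
      obtain ⟨g, hgD, hg, hguv⟩ := h.exists_other he.2 hf he.1
      have hadj : g ∈ ((⊤ : K.dualGraph.Subgraph).induce D).neighborSet f :=
        ⟨hf, hgD, hg.symm, u, v, he.1, hguv⟩
      refine ⟨g, hadj, ?_⟩
      have h1 := hφf g hadj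
      have h2 := hφg g hadj
      revert h1 h2
      induction φ g hadj with
      | _ a b => exact fun h1 h2 => hK.edge_unique hg.symm he.1 hguv h1 h2

/-- The edges of a facet split into boundary edges and edges shared inside `D`. Each of the `n`
boundary edges lies in exactly one facet, and the shared ones sum to the degrees in the tree, `2 *
(k - 1)`. -/
lemma degree_sum [Finite V] (hK : K.IsPolyhedralMap)
    (hT : ((⊤ : K.dualGraph.Subgraph).induce D).coe.IsTree) :
    ∑ᶠ f ∈ D, (K.dualGraph.neighborSet f).ncard = Nat.card V + 2 * (D.ncard - 1) := by
  classical
  let := Fintype.ofFinite V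
  let : Fintype K.facets := Fintype.ofFinite _
  set T := (⊤ : K.dualGraph.Subgraph).induce D with hTdef
  rw [← finsum_set_coe_eq_finsum_mem, finsum_eq_sum_of_fintype]
  have hsplit : ∀ x : D, (K.dualGraph.neighborSet x.1).ncard =
      (x.1.1.edgeSet ∩ C.edgeSet).ncard + (T.neighborSet x.1).ncard := by
    intro x
    rw [hK.ncard_neighborSet, ← (PolygonalComplex.isCycleGraph x.1).ncard_edgeSet,
      h.ncard_diff hK x.2, Set.ncard_inter_add_ncard_sdiff_eq_ncard _ _ (Set.toFinite _)]
  rw [Finset.sum_congr rfl fun x _ => hsplit x, Finset.sum_add_distrib]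
  congr 1
  · have hne : Nonempty D := by
      obtain ⟨x⟩ := hT.connected.nonempty
      exact ⟨⟨x.1, x.2⟩⟩
    -- The facet assigned to an edge off `C` is arbitrary; only the fibres over edges of `C` are
    -- counted.
    have hex : ∀ e : Sym2 V, ∃ x : D, e ∈ C.edgeSet → e ∈ x.1.1.edgeSet := by
      intro e
      by_cases he : e ∈ C.edgeSet
      · induction e with
        | _ u v =>
          obtain ⟨f, hf, hfu⟩ := h.exists_facet he
          exact ⟨⟨f, hf⟩, fun _ => hfu⟩
      · exact ⟨hne.some, fun h => absurd h he⟩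
    choose φ hφ using hex
    have hfib := Finset.card_eq_sum_card_fiberwise (f := φ) (s := C.edgeSet.toFinite.toFinset)
      (t := Finset.univ) (fun _ _ => Finset.mem_coe.mpr (Finset.mem_univ _))
    rw [← Set.ncard_eq_toFinset_card _ C.edgeSet.toFinite, h.isCycleGraph.ncard_edgeSet,
      Set.eq_univ_of_forall h.mem_verts, Set.ncard_univ] at hfib
    rw [hfib]
    refine Finset.sum_congr rfl fun x _ => ?_
    rw [← Set.ncard_coe_finset]
    congr 1
    ext e
    simp only [Set.mem_inter_iff, Finset.coe_filter, Set.Finite.mem_toFinset, Set.mem_ofPred_eq]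
    constructor
    · rintro ⟨h1, h2⟩
      refine ⟨h2, ?_⟩
      have h3 := hφ e h2
      revert h1 h2 h3
      induction e with
      | _ u v =>
        intro h1 h2 h3
        exact Subtype.ext (h.facet_unique h2 (φ s(u, v)).2 x.2 h3 h1)
    · rintro ⟨h2, rfl⟩
      exact ⟨hφ e h2, h2⟩
  · have hdeg : ∀ x : T.verts, (T.neighborSet x.1).ncard = T.coe.degree x := by
      intro x
      rw [Subgraph.coe_degree, ← Subgraph.finset_card_neighborSet_eq_degree,
        Set.ncard_eq_toFinset_card']
    have h1 : ∑ x : T.verts, (T.neighborSet x.1).ncard = 2 * (D.ncard - 1) := by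
      have hs : ∑ x : T.verts, T.coe.degree x = 2 * T.coe.edgeFinset.card := by
        convert T.coe.sum_degrees_eq_twice_card_edges
      rw [Finset.sum_congr rfl fun x _ => hdeg x, hs]
      have := hT.card_edgeFinset
      have hc : Fintype.card T.verts = D.ncard := by
        rw [Set.ncard_eq_toFinset_card', Set.toFinset_card]
        rfl
      omega
    exact h1

/-- Connectedness comes from `exists_adj_of_partition`, applied to a connected component. Each edge
is a bridge because its potential is constant along any walk avoiding it but differs at its two
ends. -/
lemma isTree [Finite V] (hK : K.IsPolyhedralMap) (hd : K.BoundsDisc C D) :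
    ((⊤ : K.dualGraph.Subgraph).induce D).coe.IsTree := by
  set T := (⊤ : K.dualGraph.Subgraph).induce D with hTdef
  have hTadj : ∀ x y : T.verts, T.coe.Adj x y ↔ K.dualGraph.Adj x.1 y.1 := fun x y =>
    ⟨fun h => h.2.2, fun h => ⟨x.2, y.2, h⟩⟩
  refine ⟨?_, ?_⟩
  · have ⟨e, _⟩ := hd
    obtain ⟨f₀, hf₀, -⟩ := mem_region_iff.mp (e.symm ⟨0, by simp⟩).2
    have : Nonempty T.verts := ⟨⟨f₀, hf₀⟩⟩
    refine ⟨fun f g => ?_⟩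
    by_contra hfg
    obtain ⟨j, hj, j', hj', hjS, hj'S, a, b, hab, hab'⟩ := hd.exists_adj_of_partition h.exists_adj
      {j | ∃ hj : j ∈ D, T.coe.Reachable f ⟨j, hj⟩} f.2 ⟨f.2, Reachable.refl _⟩ g.2
      (fun hg => hfg hg.2)
    refine hj'S ⟨hj', hjS.2.trans (Adj.reachable ?_)⟩
    rw [hTadj]
    exact ⟨fun he => hj'S (by rw [← show j = j' from he]; exact hjS), a, b, hab, hab'⟩
  · rw [isAcyclic_iff_forall_adj_isBridge]
    intro f g hfg
    obtain ⟨hne, u, v, hfu, hgu⟩ := (hTadj f g).mp hfg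
    obtain ⟨N, hN, hN'⟩ := hd.exists_potential hK h.exists_adj hne f.2 g.2 hfu hgu
      (fun huv => hne (h.facet_unique huv f.2 g.2 hfu hgu))
    rw [isBridge_iff]
    rintro ⟨p⟩
    refine hN ?_
    have : ∀ {x y : T.verts} (p : (T.coe.deleteEdges {s(f, g)}).Walk x y), N x.1 = N y.1 := by
      intro x y p
      induction p with
      | nil => rfl
      | @cons x y z hxy p ih =>
        rw [← ih]
        rw [deleteEdges_adj] at hxy
        obtain ⟨hxyne, a, b, hxa, hya⟩ := (hTadj x y).mp hxy.1
        refine hN' x.1 x.2 y.1 y.2 a b hxa hya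
          (fun hab => hxyne (h.facet_unique hab x.2 y.2 hxa hya)) fun hab => hxy.2 ?_
        have hxu : x.1.1.Adj u v := by rwa [← Subgraph.mem_edgeSet, ← hab, Subgraph.mem_edgeSet]
        have hyu : y.1.1.Adj u v := by rwa [← Subgraph.mem_edgeSet, ← hab, Subgraph.mem_edgeSet]
        rw [Set.mem_singleton_iff, Sym2.eq_iff]
        have h1 := hK.eq_or_eq hne hfu hgu hxu
        have h2 := hK.eq_or_eq hne hfu hgu hyu
        simp only [Subtype.ext_iff] at h1 h2 hxyne ⊢
        grind
    exact this p

/-- A path in the face boundary at `v` that avoids a boundary edge and has its ends in the disc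
stays in the disc. -/
lemma support_subset (hK : K.IsPolyhedralMap) {v u₀ : V} (hu₀ : C.Adj v u₀) {a b : K.facets}
    (hab : a ≠ b) (ha : a.1.Adj v u₀) (hb : b.1.Adj v u₀) {f g : K.facets}
    (q : K.dualGraph.Walk f g) (hq : q.IsPath)
    (hqv : ∀ x y, s(x, y) ∈ q.edges → (K.dualFace v).Adj x y) (hqab : s(a, b) ∉ q.edges)
    (hf : f ∈ D) (hg : g ∈ D) : ∀ x ∈ q.support, x ∈ D := by
  classical
  intro x hx
  by_contra hxD
  have hedge : ∀ y z, s(y, z) ∈ q.edges → y ∈ D → z ∉ D →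
      ∃ u, u ≠ u₀ ∧ C.Adj v u ∧ y.1.Adj v u ∧ z.1.Adj v u := by
    intro y z hyz hy hz
    obtain ⟨hne, u, hyu, hzu⟩ := hqv y z hyz
    refine ⟨u, ?_, ?_, hyu, hzu⟩
    · rintro rfl
      have h1 := hK.eq_or_eq hab ha hb hyu
      have h2 := hK.eq_or_eq hab ha hb hzu
      apply hqab
      have : s(a, b) = s(y, z) := by rw [Sym2.eq_iff]; grind
      rwa [this]
    · by_contra hC
      exact hz (h.mem_of_mem hK hC hne hy hyu hzu)
  -- A visit outside `D` means one exit and one return, each across an edge of `C` at `v`. With `u₀`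
  -- these would be three boundary edges at `v`, where `C` has only two.
  obtain ⟨d₁, hd₁, hd₁f, hd₁s⟩ := (q.takeUntil x hx).exists_boundary_dart D hf hxD
  obtain ⟨d₂, hd₂, hd₂f, hd₂s⟩ := (q.dropUntil x hx).exists_boundary_dart Dᶜ hxD (by simpa using hg)
  have he₁ : d₁.edge ∈ (q.takeUntil x hx).edges := List.mem_map_of_mem hd₁
  have he₂ : d₂.edge ∈ (q.dropUntil x hx).edges := List.mem_map_of_mem hd₂
  have hdisj := hq.isTrail.disjoint_edges_takeUntil_dropUntil hx
  have hde : d₁.edge ≠ d₂.edge := fun he => hdisj he₁ (he ▸ he₂)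
  obtain ⟨u₁, hu₁, hCu₁, hy₁, hz₁⟩ := hedge d₁.fst d₁.snd
    (q.edges_takeUntil_subset_edges hx he₁) hd₁f hd₁s
  obtain ⟨u₂, hu₂, hCu₂, hy₂, hz₂⟩ := hedge d₂.snd d₂.fst
    (by rw [Sym2.eq_swap]; exact q.edges_dropUntil_subset_edges hx he₂) (by simpa using hd₂s) hd₂f
  have hu₁₂ : u₁ ≠ u₂ := by
    rintro rfl
    have h1 := hK.eq_or_eq d₁.adj.1 hy₁ hz₁ hy₂
    have h2 := hK.eq_or_eq d₁.adj.1 hy₁ hz₁ hz₂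
    have hne := d₂.adj.1
    apply hde
    change s(d₁.fst, d₁.snd) = s(d₂.fst, d₂.snd)
    rw [Sym2.eq_iff]
    grind
  have hsub : (({u₀, u₁, u₂} : Finset V) : Set V) ⊆ C.neighborSet v := by
    intro w hw
    simp only [Finset.coe_insert, Finset.coe_singleton, Set.mem_insert_iff,
      Set.mem_singleton_iff] at hw
    rcases hw with rfl | rfl | rfl
    · exact hu₀
    · exact hCu₁
    · exact hCu₂
  have hfin : (C.neighborSet v).Finite := Set.finite_of_ncard_ne_zero (by
    rw [h.ncard_neighborSet]; norm_num)
  have hle := Set.ncard_le_ncard hsub hfin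
  rw [h.ncard_neighborSet, Set.ncard_coe_finset,
    Finset.card_eq_three.mpr ⟨u₀, u₁, u₂, hu₁.symm, hu₂.symm, hu₁₂, rfl⟩] at hle
  omega

/-- The boundary of the face is cut open between a facet `a` inside and a facet `b` outside the
disc. The stretch from `f` to `g` of the remaining path stays in `D` by `support_subset`. -/
lemma path_mem (hK : K.IsPolyhedralMap) (v : V) (f g : K.facets) (hf : f ∈ D) (hg : g ∈ D)
    (hfv : f ∈ (K.dualFace v).verts) (hgv : g ∈ (K.dualFace v).verts) :
    ∃ p : K.dualGraph.Walk f g, p.IsPath ∧ p.toSubgraph ≤ K.dualFace v ∧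
      p.toSubgraph ≤ (⊤ : K.dualGraph.Subgraph).induce D := by
  classical
  obtain ⟨u₀, hu₀, a, ha, b, hb, hau, hbu⟩ := h.exists_in_out hK v
  have hab : a ≠ b := by rintro rfl; exact hb ha
  obtain ⟨p, hp, -, hpab, hpv, hpadj⟩ :=
    (hK.vertex_cycle v).exists_path (u := a) (v := b) ⟨hab, u₀, hau, hbu⟩
  have key : ∀ {f g : K.facets} (q : K.dualGraph.Walk f g), q.IsPath → q.edges ⊆ p.edges →
      q.support ⊆ p.support → f ∈ D → g ∈ D → q.toSubgraph ≤ K.dualFace v ∧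
      q.toSubgraph ≤ (⊤ : K.dualGraph.Subgraph).induce D := by
    intro f g q hq hqe hqs hf hg
    have hqv : ∀ x y, s(x, y) ∈ q.edges → (K.dualFace v).Adj x y := fun x y hxy =>
      (hpadj x y).mpr (Or.inl (hqe hxy))
    have hsup := h.support_subset hK hu₀ hab hau hbu q hq hqv (fun he => hpab (hqe he)) hf hg
    refine ⟨⟨fun x hx => ?_, fun x y hxy => ?_⟩, ⟨fun x hx => ?_, fun x y hxy => ?_⟩⟩
    · rw [Walk.mem_verts_toSubgraph] at hx
      exact (hpv x).mp (hqs hx)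
    · exact hqv x y (Walk.adj_toSubgraph_iff_mem_edges.mp hxy)
    · rw [Walk.mem_verts_toSubgraph] at hx
      exact hsup x hx
    · have he := Walk.adj_toSubgraph_iff_mem_edges.mp hxy
      exact ⟨hsup x (q.fst_mem_support_of_mem_edges he), hsup y (q.snd_mem_support_of_mem_edges he),
        hxy.adj_sub⟩
  have hfp : f ∈ p.support := (hpv f).mpr hfv
  have hgp : g ∈ p.support := (hpv g).mpr hgv
  rw [← p.take_spec hfp, Walk.mem_support_append_iff] at hgp
  rcases hgp with hgp | hgp
  · refine ⟨((p.takeUntil f hfp).dropUntil g hgp).reverse,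
      ((hp.takeUntil hfp).dropUntil hgp).reverse, ?_⟩
    rw [Walk.toSubgraph_reverse]
    exact key _ ((hp.takeUntil hfp).dropUntil hgp)
      (List.Subset.trans (Walk.edges_dropUntil_subset_edges _ _)
        (Walk.edges_takeUntil_subset_edges _ _))
      (List.Subset.trans (Walk.support_dropUntil_subset_support _ _)
        (Walk.support_takeUntil_subset_support _ _)) hg hf
  · refine ⟨(p.dropUntil f hfp).takeUntil g hgp, (hp.dropUntil hfp).takeUntil hgp, ?_⟩
    exact key _ ((hp.dropUntil hfp).takeUntil hgp)
      (List.Subset.trans (Walk.edges_takeUntil_subset_edges _ _)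
        (Walk.edges_dropUntil_subset_edges _ _))
      (List.Subset.trans (Walk.support_takeUntil_subset_support _ _)
        (Walk.support_dropUntil_subset_support _ _)) hf hg

/-- Some facet at `v` is outside `D`, so the path has at most `q - 1` vertices. -/
lemma path_length [Finite V] (hK : K.IsPolyhedralMap) (v : V) {f g : K.facets}
    (p : K.dualGraph.Walk f g) (hp : p.IsPath)
    (hpD : p.toSubgraph ≤ (⊤ : K.dualGraph.Subgraph).induce D)
    (hpv : p.toSubgraph ≤ K.dualFace v) : p.length + 2 ≤ (K.dualFace v).edgeSet.ncard := by
  classical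
  obtain ⟨u₀, hu₀, a, ha, b, hb, hau, hbu⟩ := h.exists_in_out hK v
  have hbp : b ∉ p.support := fun hbs =>
    hb (hpD.1 ((Walk.mem_verts_toSubgraph p).mpr hbs))
  have hsub : ((insert b p.support.toFinset : Finset K.facets) : Set K.facets) ⊆
      (K.dualFace v).verts := by
    intro x hx
    simp only [Finset.coe_insert, Set.mem_insert_iff, List.coe_toFinset, Set.mem_ofPred_eq] at hx
    rcases hx with rfl | hx
    · exact hbu.fst_mem
    · exact hpv.1 ((Walk.mem_verts_toSubgraph p).mpr hx)
  have hle := Set.ncard_le_ncard hsub (Set.toFinite _)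
  rw [Set.ncard_coe_finset, Finset.card_insert_of_notMem (by simpa using hbp),
    List.toFinset_card_of_nodup hp.support_nodup, Walk.length_support] at hle
  rw [(hK.vertex_cycle v).ncard_edgeSet]
  omega

end IsSpanningBoundary

theorem HasContractibleHamiltonianCycle.exists_isProperTree [Finite V] [DecidableEq V]
    (hK : K.IsPolyhedralMap) (h : K.HasContractibleHamiltonianCycle) :
    ∃ T : K.dualGraph.Subgraph, K.IsProperTree T := by
  obtain ⟨a, w, hw, D, hd⟩ := h
  have hb := hd.isSpanningBoundary hK hw
  have hT := hb.isTree hK hd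
  exact ⟨(⊤ : K.dualGraph.Subgraph).induce D, hT, hb.degree_sum hK hT,
    fun v f g hf hg hfv hgv => hb.path_mem hK v f g hf hg hfv hgv,
    fun v f g p hp hpT hpv => hb.path_length hK v p hp hpT hpv⟩

end PolygonalComplex

theorem theorem2 {V : Type*} [Finite V] [DecidableEq V] (K : PolygonalComplex V)
    (hK : K.IsPolyhedralMap) :
    K.HasContractibleHamiltonianCycle ↔
      ∃ T : K.dualGraph.Subgraph, K.IsProperTree T :=
  ⟨fun h => h.exists_isProperTree hK, fun ⟨_, hT⟩ => hT.hasContractibleHamiltonianCycle hK⟩
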